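/- Conventions. Manifolds are smooth, Hausdorff, second countable, finite-dimensional and without boundary. A weighting of a manifold $M$ is a multiplicative filtration $C^\infty_M=C^\infty_{M,(0)}\supseteq C^\infty_{M,(1)}\supseteq C^\infty_{M,(2)}\supseteq\cdots$ of the sheaf of smooth functions by sheaves of ideals such that every point of $M$ has an open neighbourhood $U$ with coordinates $x_1,\dots,x_n$ on $U$ and a weight vector $w\in\mathbb{Z}_{\ge 0}^n$ for which, for every $i\ge 0$, $C^\infty_{M,(i)}(U)$ is the ideal of $C^\infty(U)$ generated by the monomials $x_1^{s_1}\cdots x_n^{s_n}$ with $\sum_a w_as_a\ge i$; such coordinates are called weighted coordinates. A weighted pair $(M,N)$ is a manifold $M$ with a weighting, where $N\subseteq M$ is the set of points at which the filtration is non-trivial (i.e. at which the stalk of some $C^\infty_{M,(i)}$ is a proper ideal of the stalk of $C^\infty_M$). For $p\in N$ and $i\ge 0$ let $(T^*_pM)_{(i)}=\mathrm{span}\{\mathrm{d}_pg : g\in C^\infty(M)_{(i)}\}$, and let $(T_pM)_{(-i)}\subseteq T_pM$ be the annihilator of $(T^*_pM)_{(i+1)}$; these are the fibres of the induced filtration of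 $TM|_N$. A smooth map $f:M\to M'$ between weighted manifolds is a weighted morphism if $f^*C^\infty_{M',(i)}\subseteq C^\infty_{M,(i)}$ for all $i\geq 0$. If $(M,N)$ and $(M',N')$ are weighted pairs, $M'\times M$ carries the product weighting along $N'\times N$, whose degree $i$ part is the sheaf of ideals generated by the products $g'(y)\,g(x)$ of local functions $g'\in C^\infty_{M',(j)}$ and $g\in C^\infty_{M,(k)}$ with $j+k=i$. A subset $R\subseteq M$ is a weighted submanifold of $(M,N)$ if it is an embedded submanifold and near every point $p\in R\cap N$ there are weighted coordinates $x_1,\dots,x_n$ on a neighbourhood $U$ of $p$ which are also submanifold coordinates for $R$, i.e. $R\cap U=\{x_a=0 \text{ for all } a\in J\}$ for some set $J$ of indices. Theorem. Let $(M,N)$ and $(M',N')$ be weighted pairs and let $f:(M,N)\to(M',N')$ be a smooth map of pairs, i.e. a smooth map $f:M\to M'$ with $f(N)\subseteq N'$. Then $f$ is a weighted morphism if and only if (a) the graph $\Gamma(f)=\{(f(x),x) : x\in M\}\subseteq M'\times M$ is a weighted submanifold of $(M'\times M,N'\times N)$, and (b) $Tf:TM|_N\to TM'|_{N'}$ is filtration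 preserving, i.e. $T_pf\big((T_pM)_{(-i)}\big)\subseteq (T_{f(p)}M')_{(-i)}$ for all $p\in N$ and all $i\ge 0$. -/

import Mathlib

open scoped Manifold ContDiff
open Set TopologicalSpace

noncomputable section

namespace WeightedManifold

variable {E : Type*} [NormedAddCommGroup E] [NormedSpace ℝ E]
  {H : Type*} [TopologicalSpace H] {I : ModelWithCorners ℝ E H}
  {M : Type*} [TopologicalSpace M] [ChartedSpace H M]
  {E' : Type*} [NormedAddCommGroup E'] [NormedSpace ℝ E']
  {H' : Type*} [TopologicalSpace H'] {I' : ModelWithCorners ℝ E' H'}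
  {M' : Type*} [TopologicalSpace M'] [ChartedSpace H' M']

/-- Pull-back of smooth functions along a smooth map `f : M → M'` which maps the open set `U ⊆ M`
into the open set `V ⊆ M'`: the ring homomorphism `C^∞(V) → C^∞(U)`, `g ↦ g ∘ f`. -/
def pullback (f : C^∞⟮I, M; I', M'⟯) (U : Opens M) (V : Opens M') (h : ∀ x ∈ U, f x ∈ V) :
    C^∞⟮I', V; 𝓘(ℝ), ℝ⟯ →+* C^∞⟮I, U; 𝓘(ℝ), ℝ⟯ where
  toFun g := ⟨fun x => g ⟨f x.1, h x.1 x.2⟩, by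
    refine ContMDiff.comp (I' := I') g.contMDiff ?_
    rw [← ContMDiff.subtypeVal_comp_iff]
    exact f.contMDiff.comp contMDiff_subtype_val⟩
  map_one' := rfl
  map_mul' _ _ := rfl
  map_zero' := rfl
  map_add' _ _ := rfl

/-- The product open set `V × U ⊆ M' × M`. -/
def openProd (V : Opens M') (U : Opens M) : Opens (M' × M) := ⟨V ×ˢ U, V.2.prod U.2⟩

theorem openProd_mono {V₁ V₂ : Opens M'} {U₁ U₂ : Opens M} (hV : V₂ ≤ V₁) (hU : U₂ ≤ U₁) :
    openProd V₂ U₂ ≤ openProd V₁ U₁ := fun _ hz => ⟨hV hz.1, hU hz.2⟩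

theorem exists_openProd_le (O : Opens (M' × M)) (z : M' × M) (hz : z ∈ O) :
    ∃ (V : Opens M') (U : Opens M), z ∈ openProd V U ∧ openProd V U ≤ O := by
  obtain ⟨v, u, hv, hu, h1, h2, hs⟩ := isOpen_prod_iff.1 O.2 z.1 z.2 hz
  exact ⟨⟨v, hv⟩, ⟨u, hu⟩, ⟨h1, h2⟩, hs⟩

/-- Restriction of smooth functions `C^∞(U) → C^∞(V)`, for open sets `V ⊆ U`. -/
abbrev restrict {U V : Opens M} (h : V ≤ U) :
    C^∞⟮I, U; 𝓘(ℝ), ℝ⟯ →+* C^∞⟮I, V; 𝓘(ℝ), ℝ⟯ :=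
  ContMDiffMap.restrictRingHom I 𝓘(ℝ) ℝ h

variable (I M) in
/-- A multiplicative filtration `C^∞_M = C^∞_{M,(0)} ⊇ C^∞_{M,(1)} ⊇ C^∞_{M,(2)} ⊇ ⋯` of the sheaf
of smooth functions on `M` by sheaves of ideals. -/
structure FunctionFiltration where
  /-- `ideal i U` is `C^∞_{M,(i)}(U)`. -/
  ideal : ℕ → ∀ U : Opens M, Ideal C^∞⟮I, U; 𝓘(ℝ), ℝ⟯
  ideal_zero : ∀ U, ideal 0 U = ⊤
  antitone : ∀ U, Antitone fun i => ideal i U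
  mul_le : ∀ U i j, ideal i U * ideal j U ≤ ideal (i + j) U
  restrict_mem : ∀ (i : ℕ) {U V : Opens M} (h : V ≤ U), ∀ g ∈ ideal i U, restrict h g ∈ ideal i V
  mem_of_locally : ∀ (i : ℕ) (U : Opens M) (g : C^∞⟮I, U; 𝓘(ℝ), ℝ⟯),
    (∀ p ∈ U, ∃ (V : Opens M) (h : V ≤ U), p ∈ V ∧ restrict h g ∈ ideal i V) → g ∈ ideal i U

variable (I M) in
/-- A local coordinate system `x_1, …, x_n` on an open subset of `M`: a chart of the maximal smooth
atlas together with a basis of the model vector space. -/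
structure LocalCoordinates where
  chart : OpenPartialHomeomorph M H
  chart_mem : chart ∈ IsManifold.maximalAtlas I ∞ M
  basis : Module.Basis (Fin (Module.finrank ℝ E)) ℝ E

namespace LocalCoordinates

variable (x : LocalCoordinates I M)

/-- The open set `U` on which the coordinates are defined. -/
def domain : Opens M := ⟨x.chart.source, x.chart.open_source⟩

/-- The coordinate function `x_a : U → ℝ`. -/
def coord (a : Fin (Module.finrank ℝ E)) : C^∞⟮I, x.domain; 𝓘(ℝ), ℝ⟯ :=
  ⟨fun q => x.basis.repr (I (x.chart q.1)) a, by
    have hfin : FiniteDimensional ℝ E := x.basis.finiteDimensional_of_finite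
    have h1 : ContMDiffOn I I ∞ x.chart x.chart.source :=
      contMDiffOn_of_mem_maximalAtlas x.chart_mem
    have h2 : ContMDiff I I ∞ fun q : x.domain => x.chart q.1 :=
      h1.comp_contMDiff contMDiff_subtype_val fun q => q.2
    have h3 : ContMDiff I 𝓘(ℝ, E) ∞ fun q : x.domain => I (x.chart q.1) :=
      I.contMDiff.comp h2
    exact (LinearMap.toContinuousLinearMap (x.basis.coord a)).contMDiff.comp h3⟩

/-- The ideal of `C^∞(U)` generated by the monomials `x_1^{s_1} ⋯ x_n^{s_n}` with
`∑ w_a s_a ≥ i`. -/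
def monomialIdeal (w : Fin (Module.finrank ℝ E) → ℕ) (i : ℕ) :
    Ideal C^∞⟮I, x.domain; 𝓘(ℝ), ℝ⟯ :=
  Ideal.span {g | ∃ s : Fin (Module.finrank ℝ E) → ℕ,
    i ≤ ∑ a, w a * s a ∧ g = ∏ a, x.coord a ^ s a}

/-- `x` is a system of submanifold coordinates for `R`: there is a set `J` of indices with
`R ∩ U = {x_a = 0 for all a ∈ J}`. -/
def IsSubmanifoldCoordinates (R : Set M) : Prop :=
  ∃ J : Set (Fin (Module.finrank ℝ E)),
    ∀ q : x.domain, (q : M) ∈ R ↔ ∀ a ∈ J, x.coord a q = 0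

end LocalCoordinates

/-- An (embedded) submanifold of `M`: a subset covered by domains of submanifold coordinates. -/
def IsSubmanifold (I : ModelWithCorners ℝ E H) (R : Set M) : Prop :=
  ∀ p ∈ R, ∃ x : LocalCoordinates I M, p ∈ x.domain ∧ x.IsSubmanifoldCoordinates R

namespace FunctionFiltration

section Basic

variable (W : FunctionFiltration I M) (W' : FunctionFiltration I' M')

/-- `x` is a system of weighted coordinates, with weight vector `w`: the filtration of `C^∞(U)` is
the one by the ideals generated by monomials of weighted degree at least `i`. -/
def IsWeightedCoordinates (x : LocalCoordinates I M) (w : Fin (Module.finrank ℝ E) → ℕ) : Prop :=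
  ∀ i, W.ideal i x.domain = x.monomialIdeal w i

/-- The filtration is a weighting of `M` if every point lies in the domain of some weighted
coordinates. -/
def IsWeighting : Prop :=
  ∀ p : M, ∃ (x : LocalCoordinates I M) (w : Fin (Module.finrank ℝ E) → ℕ),
    p ∈ x.domain ∧ W.IsWeightedCoordinates x w

/-- The set `N ⊆ M` along which `M` is weighted: the points at which the filtration (of the stalk
of the sheaf of smooth functions) is non-trivial. -/
def locus : Set M := {p | ∃ i, ∀ U : Opens M, p ∈ U → W.ideal i U ≠ ⊤}

/-- The set `C^∞(M)_{(i)}` of global functions of filtration degree `i`. -/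
def globalFunctions (i : ℕ) : Set C^∞⟮I, M; 𝓘(ℝ), ℝ⟯ :=
  {g | (⟨fun x => g x.1, g.contMDiff.comp contMDiff_subtype_val⟩ :
    C^∞⟮I, (⊤ : Opens M); 𝓘(ℝ), ℝ⟯) ∈ W.ideal i ⊤}

/-- The fibre at `p` of `(T^*M|_N)_{(i)}`, spanned by the differentials at `p` of the functions in
`C^∞(M)_{(i)}`. -/
def cotangentFiltration (i : ℕ) (p : M) : Submodule ℝ (TangentSpace I p →L[ℝ] ℝ) :=
  Submodule.span ℝ {α | ∃ g ∈ W.globalFunctions i, α = mfderiv I 𝓘(ℝ) g p}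

/-- The fibre at `p` of `(TM|_N)_{(-i)}`, the annihilator of `(T^*M|_N)_{(i+1)}`. -/
def tangentFiltration (i : ℕ) (p : M) : Submodule ℝ (TangentSpace I p) where
  carrier := {v | ∀ α ∈ W.cotangentFiltration (i + 1) p, α v = 0}
  zero_mem' α _ := map_zero α
  add_mem' {v v'} hv hv' α hα := by rw [map_add, hv α hα, hv' α hα, add_zero]
  smul_mem' c v hv α hα := by rw [map_smul, hv α hα, smul_zero]

/-- `R ⊆ M` is a weighted submanifold: it is a submanifold and near each point of `R ∩ N` there are
weighted coordinates which are simultaneously submanifold coordinates for `R`. -/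
def IsWeightedSubmanifold (R : Set M) : Prop :=
  IsSubmanifold I R ∧ ∀ p ∈ R ∩ W.locus,
    ∃ (x : LocalCoordinates I M) (w : Fin (Module.finrank ℝ E) → ℕ),
      p ∈ x.domain ∧ W.IsWeightedCoordinates x w ∧ x.IsSubmanifoldCoordinates R

/-- `f` is a weighted morphism: `f^* C^∞_{M',(i)} ⊆ C^∞_{M,(i)}` for all `i`. -/
def IsWeightedMorphism (f : C^∞⟮I, M; I', M'⟯) : Prop :=
  ∀ (i : ℕ) (V : Opens M') (g : C^∞⟮I', V; 𝓘(ℝ), ℝ⟯), g ∈ W'.ideal i V →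
    pullback f (Opens.comap ⟨f, f.contMDiff.continuous⟩ V) V (fun _ hx => hx) g ∈
      W.ideal i (Opens.comap ⟨f, f.contMDiff.continuous⟩ V)

/-- `Tf : TM|_N → TM'|_{N'}` preserves the filtrations: for every `p ∈ N` and every `i` it maps
`(T_pM)_{(-i)}` into `(T_{f(p)}M')_{(-i)}`. -/
def PreservesTangentFiltration (f : C^∞⟮I, M; I', M'⟯) : Prop :=
  ∀ p ∈ W.locus, ∀ i, ∀ v ∈ W.tangentFiltration i p,
    mfderiv I I' f p v ∈ W'.tangentFiltration i (f p)

end Basic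

section Product

variable (W' : FunctionFiltration I' M') (W : FunctionFiltration I M)

/-- The ideal of `C^∞(V × U)` generated by the products `g'(y) g(x)` with `g' ∈ C^∞(V)_{(j)}`,
`g ∈ C^∞(U)_{(k)}` and `j + k = i`. -/
def boxIdeal (i : ℕ) (V : Opens M') (U : Opens M) :
    Ideal C^∞⟮I'.prod I, openProd V U; 𝓘(ℝ), ℝ⟯ :=
  Ideal.span {h | ∃ j k, j + k = i ∧ ∃ g' ∈ W'.ideal j V, ∃ g ∈ W.ideal k U,
    h = pullback ContMDiffMap.fst (openProd V U) V (fun _ hz => hz.1) g' *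
      pullback ContMDiffMap.snd (openProd V U) U (fun _ hz => hz.2) g}

theorem restrict_mem_boxIdeal (i : ℕ) {V₁ V₂ : Opens M'} {U₁ U₂ : Opens M} (hV : V₂ ≤ V₁)
    (hU : U₂ ≤ U₁) (h : openProd V₂ U₂ ≤ openProd V₁ U₁)
    (g : C^∞⟮I'.prod I, openProd V₁ U₁; 𝓘(ℝ), ℝ⟯) (hg : g ∈ W'.boxIdeal W i V₁ U₁) :
    restrict h g ∈ W'.boxIdeal W i V₂ U₂ := by
  have : W'.boxIdeal W i V₁ U₁ ≤ (W'.boxIdeal W i V₂ U₂).comap (restrict h) := by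
    refine Ideal.span_le.2 ?_
    rintro _ ⟨j, k, hjk, a, ha, b, hb, rfl⟩
    exact Ideal.subset_span ⟨j, k, hjk, restrict hV a, W'.restrict_mem j hV a ha,
      restrict hU b, W.restrict_mem k hU b hb, rfl⟩
  exact this hg

theorem boxIdeal_zero (V : Opens M') (U : Opens M) : W'.boxIdeal W 0 V U = ⊤ := by
  rw [Ideal.eq_top_iff_one]
  refine Ideal.subset_span ⟨0, 0, rfl, 1, ?_, 1, ?_, ?_⟩
  · rw [W'.ideal_zero]; trivial
  · rw [W.ideal_zero]; trivial
  · rw [map_one, map_one, one_mul]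

theorem boxIdeal_antitone (V : Opens M') (U : Opens M) :
    Antitone fun i => W'.boxIdeal W i V U := by
  intro i i' hi
  refine Ideal.span_le.2 ?_
  rintro _ ⟨j, k, hjk, a, ha, b, hb, rfl⟩
  exact Ideal.subset_span ⟨min j i, i - min j i, by omega,
    a, W'.antitone V (min_le_left j i) ha, b, W.antitone U (by omega) hb, rfl⟩

theorem boxIdeal_mul_le (i j : ℕ) (V : Opens M') (U : Opens M) :
    W'.boxIdeal W i V U * W'.boxIdeal W j V U ≤ W'.boxIdeal W (i + j) V U := by
  unfold boxIdeal
  rw [Ideal.span_mul_span']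
  refine Ideal.span_le.2 ?_
  rintro _ ⟨_, ⟨j₁, k₁, h₁, a₁, ha₁, b₁, hb₁, rfl⟩, _, ⟨j₂, k₂, h₂, a₂, ha₂, b₂, hb₂, rfl⟩, rfl⟩
  refine Ideal.subset_span ⟨j₁ + j₂, k₁ + k₂, by omega, a₁ * a₂,
    W'.mul_le V _ _ (Ideal.mul_mem_mul ha₁ ha₂), b₁ * b₂,
    W.mul_le U _ _ (Ideal.mul_mem_mul hb₁ hb₂), ?_⟩
  rw [map_mul, map_mul]
  exact mul_mul_mul_comm _ _ _ _

/-- `h ∈ C^∞(O)` belongs, near every point of `O ⊆ M' × M`, to the ideal generated by the products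
`g'(y) g(x)` of functions with filtration degrees adding up to `i`. -/
def LocallyInBoxIdeal (i : ℕ) (O : Opens (M' × M)) (h : C^∞⟮I'.prod I, O; 𝓘(ℝ), ℝ⟯) : Prop :=
  ∀ z ∈ O, ∃ (V : Opens M') (U : Opens M) (hO : openProd V U ≤ O), z ∈ openProd V U ∧
    restrict hO h ∈ W'.boxIdeal W i V U

variable {W' W} in
theorem LocallyInBoxIdeal.common {i j : ℕ} {O : Opens (M' × M)}
    {h₁ h₂ : C^∞⟮I'.prod I, O; 𝓘(ℝ), ℝ⟯} (H₁ : W'.LocallyInBoxIdeal W i O h₁)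
    (H₂ : W'.LocallyInBoxIdeal W j O h₂) (z : M' × M) (hz : z ∈ O) :
    ∃ (V : Opens M') (U : Opens M) (hO : openProd V U ≤ O), z ∈ openProd V U ∧
      restrict hO h₁ ∈ W'.boxIdeal W i V U ∧ restrict hO h₂ ∈ W'.boxIdeal W j V U := by
  obtain ⟨V₁, U₁, hO₁, hz₁, m₁⟩ := H₁ z hz
  obtain ⟨V₂, U₂, hO₂, hz₂, m₂⟩ := H₂ z hz
  have l₁ : openProd (V₁ ⊓ V₂) (U₁ ⊓ U₂) ≤ openProd V₁ U₁ :=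
    openProd_mono inf_le_left inf_le_left
  have l₂ : openProd (V₁ ⊓ V₂) (U₁ ⊓ U₂) ≤ openProd V₂ U₂ :=
    openProd_mono inf_le_right inf_le_right
  exact ⟨V₁ ⊓ V₂, U₁ ⊓ U₂, l₁.trans hO₁, ⟨⟨hz₁.1, hz₂.1⟩, ⟨hz₁.2, hz₂.2⟩⟩,
    W'.restrict_mem_boxIdeal W i inf_le_left inf_le_left l₁ _ m₁,
    W'.restrict_mem_boxIdeal W j inf_le_right inf_le_right l₂ _ m₂⟩

/-- The product filtration on `M' × M`: the filtration degree `i` part is the sheaf of ideals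
generated by the products `g'(y) g(x)` of functions with filtration degrees adding up to `i`. -/
def prod : FunctionFiltration (I'.prod I) (M' × M) where
  ideal i O :=
    { carrier := {h | W'.LocallyInBoxIdeal W i O h}
      zero_mem' := fun z hz => by
        obtain ⟨V, U, hzm, hO⟩ := exists_openProd_le O z hz
        exact ⟨V, U, hO, hzm, by rw [map_zero]; exact zero_mem _⟩
      add_mem' := fun {h₁ h₂} H₁ H₂ z hz => by
        obtain ⟨V, U, hO, hzm, m₁, m₂⟩ := H₁.common H₂ z hz
        exact ⟨V, U, hO, hzm, by rw [map_add]; exact add_mem m₁ m₂⟩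
      smul_mem' := fun c h hh z hz => by
        obtain ⟨V, U, hO, hzm, m⟩ := hh z hz
        exact ⟨V, U, hO, hzm, by
          rw [smul_eq_mul, map_mul]; exact Ideal.mul_mem_left _ _ m⟩ }
  ideal_zero O := by
    refine eq_top_iff.2 fun h _ z hz => ?_
    obtain ⟨V, U, hzm, hO⟩ := exists_openProd_le O z hz
    exact ⟨V, U, hO, hzm, by rw [boxIdeal_zero]; trivial⟩
  antitone O i j hij h hh z hz := by
    obtain ⟨V, U, hO, hzm, m⟩ := hh z hz
    exact ⟨V, U, hO, hzm, W'.boxIdeal_antitone W V U hij m⟩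
  mul_le O i j := by
    refine Ideal.mul_le.2 fun h₁ H₁ h₂ H₂ z hz => ?_
    obtain ⟨V, U, hO, hzm, m₁, m₂⟩ := LocallyInBoxIdeal.common H₁ H₂ z hz
    exact ⟨V, U, hO, hzm, by
      rw [map_mul]; exact W'.boxIdeal_mul_le W i j V U (Ideal.mul_mem_mul m₁ m₂)⟩
  restrict_mem i O O' h g hg z hz := by
    obtain ⟨V₁, U₁, hO₁, hz₁, m₁⟩ := hg z (h hz)
    obtain ⟨V₂, U₂, hz₂, hO₂⟩ := exists_openProd_le O' z hz
    have l₁ : openProd (V₁ ⊓ V₂) (U₁ ⊓ U₂) ≤ openProd V₁ U₁ :=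
      openProd_mono inf_le_left inf_le_left
    have l₂ : openProd (V₁ ⊓ V₂) (U₁ ⊓ U₂) ≤ openProd V₂ U₂ :=
      openProd_mono inf_le_right inf_le_right
    exact ⟨V₁ ⊓ V₂, U₁ ⊓ U₂, l₂.trans hO₂, ⟨⟨hz₁.1, hz₂.1⟩, ⟨hz₁.2, hz₂.2⟩⟩,
      W'.restrict_mem_boxIdeal W i inf_le_left inf_le_left l₁ _ m₁⟩
  mem_of_locally i O g hg z hz := by
    obtain ⟨O', hO', hz', hm⟩ := hg z hz
    obtain ⟨V, U, hO, hzm, m⟩ := hm z hz'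
    exact ⟨V, U, hO.trans hO', hzm, m⟩

end Product

end FunctionFiltration

/-- The graph `Γ(f) = {(f(x), x)} ⊆ M' × M`. -/
def graph (f : M → M') : Set (M' × M) := {z | z.1 = f z.2}

end WeightedManifold

end

/-! Everything is checked on stalks. Write `W_k` and `W'_k` for the stalks in degree `k`. Since the
filtrations consist of sheaves of ideals, `f` is a weighted morphism iff `f^*W'_k ⊆ W_k` at every
point.

For a weighted morphism, (b) is dual to this inclusion, because `d(f^*a)(v) = da(Tf v)`. For (a),
take weighted coordinates `x_a` on `M` and `y_b` on `M'`. The functions `y_b - f^*y_b`, `x_a` are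
coordinates on `M' × M` in which the graph is cut out by the first group. As `f^*y_b` has the same
weight as `y_b`, they generate the same filtration as `y_b`, `x_a`, so they are weighted
(`isWeightedCoordinates_graphCoordinates`).

Conversely, only points `p ∈ N` matter. Take weighted coordinates `z_c`, of weights `u_c`, adapted
to the graph near `(f(p), p)`, and let `r_c` be the pull-back of `z_c` along `γ : x ↦ (f(x), x)`.
The `r_c` with `c ∈ J` vanish, and the others have linearly independent differentials at `p`
(`exists_dual_vector`). The pull-back of the degree `k` part of the product filtration generates the
ideal `F_k` of monomials in `r` of weight at least `k`, which contains both `W_k` and `f^*W'_k`. So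
it is enough that `r_c ∈ W_{u_c}`: then `F_k ⊆ W_k`.

This is the comparison `mem_stalk_of_stalk_le_monomialSpan`. By (b) and duality, `r_c` has the same
differential at `p` as some `G_c ∈ W_k`, for each `k` with `1 ≤ k ≤ u_c`. Expand `G_c ∈ F_k` as a
combination of the nonzero `r_d` with `u_d ≥ k` plus a remainder from monomials in variables of
weight below `k`. By induction on `k` the remainder lies in `W_k`, and it has zero 1-jet. Comparing
differentials, the coefficient matrix is the identity at `p`, hence invertible over germs, and
solving the linear system puts `r_c` in `W_k`. -/

noncomputable section

namespace WeightedManifold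

open Filter Topology

/-! ### Germs of smooth functions, their pull-backs and their differentials. -/

section Germs

variable {E : Type*} [NormedAddCommGroup E] [NormedSpace ℝ E]
  {H : Type*} [TopologicalSpace H] {I : ModelWithCorners ℝ E H}
  {M : Type*} [TopologicalSpace M] [ChartedSpace H M]
  {E' : Type*} [NormedAddCommGroup E'] [NormedSpace ℝ E']
  {H' : Type*} [TopologicalSpace H'] {I' : ModelWithCorners ℝ E' H'}
  {M' : Type*} [TopologicalSpace M'] [ChartedSpace H' M']

variable (I) in
/-- `g` is smooth on a neighbourhood of `p`. -/
def SmoothNear (p : M) (g : M → ℝ) : Prop := ∀ᶠ q in 𝓝 p, ContMDiffAt I 𝓘(ℝ) ∞ g q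

theorem SmoothNear.contMDiffAt {p : M} {g : M → ℝ} (h : SmoothNear I p g) :
    ContMDiffAt I 𝓘(ℝ) ∞ g p := h.self_of_nhds

theorem SmoothNear.mdifferentiableAt {p : M} {g : M → ℝ} (h : SmoothNear I p g) :
    MDifferentiableAt I 𝓘(ℝ) g p := h.contMDiffAt.mdifferentiableAt (by simp)

variable (I) in
/-- The local ring of germs at `p` of smooth functions. -/
def smoothGerm (p : M) : Subring (Germ (𝓝 p) ℝ) where
  carrier := {a | ∃ g : M → ℝ, SmoothNear I p g ∧ (g : Germ (𝓝 p) ℝ) = a}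
  mul_mem' := by
    rintro _ _ ⟨g, hg, rfl⟩ ⟨h, hh, rfl⟩
    exact ⟨g * h, by filter_upwards [hg, hh] with q h1 h2 using h1.mul h2, rfl⟩
  one_mem' := ⟨1, Eventually.of_forall fun _ => contMDiffAt_const, rfl⟩
  add_mem' := by
    rintro _ _ ⟨g, hg, rfl⟩ ⟨h, hh, rfl⟩
    exact ⟨g + h, by filter_upwards [hg, hh] with q h1 h2 using h1.add h2, rfl⟩
  zero_mem' := ⟨0, Eventually.of_forall fun _ => contMDiffAt_const, rfl⟩
  neg_mem' := by
    rintro _ ⟨g, hg, rfl⟩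
    exact ⟨-g, by filter_upwards [hg] with q h1 using h1.neg, rfl⟩

/-- The germ of a function smooth near `p`. -/
def SmoothNear.germ {p : M} {g : M → ℝ} (h : SmoothNear I p g) : smoothGerm I p :=
  ⟨(g : Germ (𝓝 p) ℝ), g, h, rfl⟩

theorem exists_smoothNear {p : M} (a : smoothGerm I p) :
    ∃ (g : M → ℝ) (h : SmoothNear I p g), h.germ = a := by
  obtain ⟨a, g, hg, rfl⟩ := a
  exact ⟨g, hg, rfl⟩

theorem SmoothNear.germ_eq_iff {p : M} {g h : M → ℝ} (hg : SmoothNear I p g)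
    (hh : SmoothNear I p h) : hg.germ = hh.germ ↔ g =ᶠ[𝓝 p] h := by
  rw [Subtype.ext_iff]
  exact Germ.coe_eq

variable (I) in
/-- The value at `p` of a germ at `p`. -/
def germEval (p : M) : smoothGerm I p →+* ℝ :=
  (Germ.valueRingHom (x := p) (E := ℝ)).comp (smoothGerm I p).subtype

@[simp] theorem germEval_germ {p : M} {g : M → ℝ} (h : SmoothNear I p g) :
    germEval I p h.germ = g p := rfl

variable (I) in
/-- The germ at `p` of a constant function. -/
def constGerm (p : M) : ℝ →+* smoothGerm I p where
  toFun c := SmoothNear.germ (g := fun _ => c) (Eventually.of_forall fun _ => contMDiffAt_const)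
  map_one' := rfl
  map_mul' _ _ := rfl
  map_zero' := rfl
  map_add' _ _ := rfl

@[simp] theorem germEval_constGerm (p : M) (c : ℝ) : germEval I p (constGerm I p c) = c := rfl

/-- The reciprocal is smooth near `p`. This locality of the ring of germs is what later inverts a
matrix that is invertible at `p`. -/
theorem isUnit_of_germEval_ne_zero {p : M} {a : smoothGerm I p} (ha : germEval I p a ≠ 0) :
    IsUnit a := by
  obtain ⟨g, hg, rfl⟩ := exists_smoothNear a
  have hne : ∀ᶠ q in 𝓝 p, g q ≠ 0 := hg.contMDiffAt.continuousAt.eventually_ne ha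
  have hinv : SmoothNear I p (fun q => (g q)⁻¹) := by
    filter_upwards [hg, hne] with q h1 h2 using h1.inv₀ h2
  refine IsUnit.of_mul_eq_one hinv.germ (Subtype.ext (Germ.coe_eq.2 ?_))
  filter_upwards [hne] with q h2 using mul_inv_cancel₀ h2

/-- The extension by zero of a function on an open set. -/
def extend {U : Opens M} (g : C^∞⟮I, U; 𝓘(ℝ), ℝ⟯) (q : M) : ℝ := by
  classical exact if h : q ∈ U then g ⟨q, h⟩ else 0

theorem extend_apply {U : Opens M} (g : C^∞⟮I, U; 𝓘(ℝ), ℝ⟯) {q : M} (h : q ∈ U) :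
    extend g q = g ⟨q, h⟩ := by
  simp [extend, h]

theorem contMDiffAt_extend {U : Opens M} (g : C^∞⟮I, U; 𝓘(ℝ), ℝ⟯) {q : M} (h : q ∈ U) :
    ContMDiffAt I 𝓘(ℝ) ∞ (extend g) q := by
  have : ContMDiffAt I 𝓘(ℝ) ∞ (fun x : U => extend g x) ⟨q, h⟩ := by
    have e : (fun x : U => extend g x) = g := by
      ext x; exact extend_apply g x.2
    rw [e]; exact g.contMDiff.contMDiffAt
  exact contMDiffAt_subtype_iff.1 this

theorem smoothNear_extend {U : Opens M} (g : C^∞⟮I, U; 𝓘(ℝ), ℝ⟯) {p : M} (h : p ∈ U) :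
    SmoothNear I p (extend g) := by
  filter_upwards [U.2.mem_nhds h] with q hq using contMDiffAt_extend g hq

/-- The germ at `p ∈ U` of smooth functions on `U`. -/
def germHom (U : Opens M) (p : M) (hp : p ∈ U) : C^∞⟮I, U; 𝓘(ℝ), ℝ⟯ →+* smoothGerm I p where
  toFun g := (smoothNear_extend g hp).germ
  map_one' := Subtype.ext <| Germ.coe_eq.2 <| by
    filter_upwards [U.2.mem_nhds hp] with q hq
    exact extend_apply _ hq
  map_mul' g h := Subtype.ext <| Germ.coe_eq.2 <| by
    filter_upwards [U.2.mem_nhds hp] with q hq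
    refine (extend_apply _ hq).trans ?_
    change _ = extend g q * extend h q
    rw [extend_apply _ hq, extend_apply _ hq]; rfl
  map_zero' := Subtype.ext <| Germ.coe_eq.2 <| by
    filter_upwards [U.2.mem_nhds hp] with q hq
    exact extend_apply _ hq
  map_add' g h := Subtype.ext <| Germ.coe_eq.2 <| by
    filter_upwards [U.2.mem_nhds hp] with q hq
    refine (extend_apply _ hq).trans ?_
    change _ = extend g q + extend h q
    rw [extend_apply _ hq, extend_apply _ hq]; rfl

/-- The function on `U` obtained by restricting a function smooth at every point of `U`. -/
def restrictTo (U : Opens M) (g : M → ℝ) (h : ∀ q ∈ U, ContMDiffAt I 𝓘(ℝ) ∞ g q) :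
    C^∞⟮I, U; 𝓘(ℝ), ℝ⟯ :=
  ⟨fun q => g q, fun q => contMDiffAt_subtype_iff.2 (h q q.2)⟩

theorem germHom_restrictTo {U : Opens M} {g : M → ℝ} (h : ∀ q ∈ U, ContMDiffAt I 𝓘(ℝ) ∞ g q)
    {p : M} (hp : p ∈ U) (hg : SmoothNear I p g) :
    germHom U p hp (restrictTo U g h) = hg.germ := Subtype.ext <| Germ.coe_eq.2 <| by
  filter_upwards [U.2.mem_nhds hp] with q hq using extend_apply _ hq

theorem exists_germHom_eq {p : M} (a : smoothGerm I p) :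
    ∃ (U : Opens M) (hp : p ∈ U) (g : C^∞⟮I, U; 𝓘(ℝ), ℝ⟯), germHom U p hp g = a := by
  obtain ⟨g, hg, rfl⟩ := exists_smoothNear a
  obtain ⟨s, hs, ho, hp⟩ := eventually_nhds_iff.1 hg
  exact ⟨⟨s, ho⟩, hp, restrictTo _ g hs, germHom_restrictTo _ _ _⟩

@[simp] theorem germHom_restrict {U V : Opens M} (h : V ≤ U) {p : M} (hp : p ∈ V)
    (g : C^∞⟮I, U; 𝓘(ℝ), ℝ⟯) : germHom V p hp (restrict h g) = germHom U p (h hp) g :=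
  Subtype.ext <| Germ.coe_eq.2 <| by
    filter_upwards [V.2.mem_nhds hp] with q hq
    rw [extend_apply _ hq, extend_apply _ (h hq)]; rfl

theorem germHom_eq_iff {U V : Opens M} {p : M} (hU : p ∈ U) (hV : p ∈ V)
    (g : C^∞⟮I, U; 𝓘(ℝ), ℝ⟯) (g' : C^∞⟮I, V; 𝓘(ℝ), ℝ⟯) :
    germHom U p hU g = germHom V p hV g' ↔
      ∃ (O : Opens M) (h : O ≤ U) (h' : O ≤ V), p ∈ O ∧ restrict h g = restrict h' g' := by
  constructor
  · intro heq
    have : extend g =ᶠ[𝓝 p] extend g' := Germ.coe_eq.1 (Subtype.ext_iff.1 heq)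
    obtain ⟨s, hs, ho, hp⟩ := eventually_nhds_iff.1 this
    refine ⟨⟨s, ho⟩ ⊓ (U ⊓ V), inf_le_right.trans inf_le_left, inf_le_right.trans inf_le_right,
      ⟨hp, hU, hV⟩, ?_⟩
    ext ⟨q, hq⟩
    have := hs q hq.1
    rwa [extend_apply _ hq.2.1, extend_apply _ hq.2.2] at this
  · rintro ⟨O, h, h', hp, heq⟩
    rw [← germHom_restrict h hp, heq, germHom_restrict]

/-- The pull-back of germs along a smooth map sending `p` to `q`. -/
def germPullback (f : C^∞⟮I, M; I', M'⟯) {p : M} {q : M'} (hq : f p = q) :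
    smoothGerm I' q →+* smoothGerm I p where
  toFun a := ⟨a.1.compTendsto f (hq ▸ f.contMDiff.continuous.continuousAt), by
    obtain ⟨g, hg, rfl⟩ := exists_smoothNear a
    subst hq
    refine ⟨g ∘ f, ?_, rfl⟩
    filter_upwards [f.contMDiff.continuous.continuousAt.eventually hg] with x hx
    exact hx.comp x f.contMDiff.contMDiffAt⟩
  map_one' := rfl
  map_mul' a b := by
    obtain ⟨g, hg, rfl⟩ := exists_smoothNear a
    obtain ⟨h, hh, rfl⟩ := exists_smoothNear b
    rfl
  map_zero' := rfl
  map_add' a b := by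
    obtain ⟨g, hg, rfl⟩ := exists_smoothNear a
    obtain ⟨h, hh, rfl⟩ := exists_smoothNear b
    rfl

theorem SmoothNear.comp {f : C^∞⟮I, M; I', M'⟯} {p : M} {q : M'} {g : M' → ℝ}
    (hg : SmoothNear I' q g) (hq : f p = q) : SmoothNear I p (g ∘ f) := by
  subst hq
  filter_upwards [f.contMDiff.continuous.continuousAt.eventually hg] with x hx
  exact hx.comp x f.contMDiff.contMDiffAt

theorem germPullback_germ (f : C^∞⟮I, M; I', M'⟯) {p : M} {q : M'} (hq : f p = q) {g : M' → ℝ}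
    (hg : SmoothNear I' q g) : germPullback f hq hg.germ = (hg.comp hq).germ := rfl

@[simp] theorem germEval_germPullback (f : C^∞⟮I, M; I', M'⟯) {p : M} {q : M'} (hq : f p = q)
    (a : smoothGerm I' q) : germEval I p (germPullback f hq a) = germEval I' q a := by
  obtain ⟨g, hg, rfl⟩ := exists_smoothNear a
  rw [germPullback_germ, germEval_germ, germEval_germ, ← hq]; rfl

theorem germPullback_germHom (f : C^∞⟮I, M; I', M'⟯) {p : M} {q : M'} (hq : f p = q)
    {U : Opens M} {V : Opens M'} (h : ∀ x ∈ U, f x ∈ V) (hp : p ∈ U) (hqV : q ∈ V)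
    (g : C^∞⟮I', V; 𝓘(ℝ), ℝ⟯) :
    germPullback f hq (germHom V q hqV g) = germHom U p hp (pullback f U V h g) :=
  Subtype.ext <| Germ.coe_eq.2 <| by
    filter_upwards [U.2.mem_nhds hp] with x hx
    rw [extend_apply _ hx, Function.comp_apply, extend_apply _ (h x hx)]; rfl

/-- The pull-back of germs along the projection `M' × M → M'`. -/
def germFst (z : M' × M) : smoothGerm I' z.1 →+* smoothGerm (I'.prod I) z :=
  germPullback ContMDiffMap.fst rfl

/-- The pull-back of germs along the projection `M' × M → M`. -/
def germSnd (z : M' × M) : smoothGerm I z.2 →+* smoothGerm (I'.prod I) z :=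
  germPullback ContMDiffMap.snd rfl

variable (I) in
/-- The differential at `p` of a germ at `p`. -/
def germDiff {p : M} (a : smoothGerm I p) : TangentSpace I p →L[ℝ] ℝ :=
  mfderiv I 𝓘(ℝ) (exists_smoothNear a).choose p

/-- The representative chosen in `germDiff` is immaterial: two representatives agree near `p`. -/
theorem germDiff_germ {p : M} {g : M → ℝ} (h : SmoothNear I p g) :
    germDiff I h.germ = mfderiv I 𝓘(ℝ) g p := by
  have hs := (exists_smoothNear h.germ).choose_spec
  have := (SmoothNear.germ_eq_iff _ _).1 hs.choose_spec
  exact this.mfderiv_eq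

theorem germDiff_add {p : M} (a b : smoothGerm I p) :
    germDiff I (a + b) = germDiff I a + germDiff I b := by
  obtain ⟨g, hg, rfl⟩ := exists_smoothNear a
  obtain ⟨h, hh, rfl⟩ := exists_smoothNear b
  have hs : SmoothNear I p (g + h) := by filter_upwards [hg, hh] with q h1 h2 using h1.add h2
  have e : hg.germ + hh.germ = hs.germ := rfl
  rw [e, germDiff_germ, germDiff_germ, germDiff_germ]
  exact (hg.mdifferentiableAt.hasMFDerivAt.add hh.mdifferentiableAt.hasMFDerivAt).mfderiv

theorem germDiff_mul {p : M} (a b : smoothGerm I p) (v : TangentSpace I p) :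
    germDiff I (a * b) v = germEval I p a * germDiff I b v + germEval I p b * germDiff I a v := by
  obtain ⟨g, hg, rfl⟩ := exists_smoothNear a
  obtain ⟨h, hh, rfl⟩ := exists_smoothNear b
  have hs : SmoothNear I p (g * h) := by filter_upwards [hg, hh] with q h1 h2 using h1.mul h2
  have e : hg.germ * hh.germ = hs.germ := rfl
  rw [e, germDiff_germ, germDiff_germ, germDiff_germ]
  have := (hg.mdifferentiableAt.hasMFDerivAt.mul hh.mdifferentiableAt.hasMFDerivAt).mfderiv
  rw [this]
  rfl

theorem germDiff_constGerm {p : M} (c : ℝ) : germDiff I (constGerm I p c) = 0 := by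
  have h : SmoothNear I p fun _ => c := Eventually.of_forall fun _ => contMDiffAt_const
  exact (germDiff_germ h).trans mfderiv_const

theorem germDiff_germPullback (f : C^∞⟮I, M; I', M'⟯) {p : M}
    (a : smoothGerm I' (f p)) (v : TangentSpace I p) :
    germDiff I (germPullback f rfl a) v = germDiff I' a (mfderiv I I' f p v) := by
  obtain ⟨g, hg, rfl⟩ := exists_smoothNear a
  rw [germPullback_germ, germDiff_germ, germDiff_germ,
    mfderiv_comp p hg.mdifferentiableAt (f.contMDiff.mdifferentiableAt (by simp))]
  rfl

variable (I) in
/-- The derivation `a ↦ d_p a (v)` of the ring of germs at `p`. -/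
def germDeriv {p : M} (v : TangentSpace I p) : smoothGerm I p →+ ℝ where
  toFun a := germDiff I a v
  map_zero' := by
    rw [← map_zero (constGerm I p), germDiff_constGerm]; rfl
  map_add' a b := by rw [germDiff_add]; rfl

end Germs

/-! ### Stalks of a filtration, and duality with the tangent filtration. -/

namespace FunctionFiltration

variable {E : Type*} [NormedAddCommGroup E] [NormedSpace ℝ E]
  {H : Type*} [TopologicalSpace H] {I : ModelWithCorners ℝ E H}
  {M : Type*} [TopologicalSpace M] [ChartedSpace H M]
  {E' : Type*} [NormedAddCommGroup E'] [NormedSpace ℝ E']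
  {H' : Type*} [TopologicalSpace H'] {I' : ModelWithCorners ℝ E' H'}
  {M' : Type*} [TopologicalSpace M'] [ChartedSpace H' M']

/-- The stalk at `p` of the sheaf of ideals `C^∞_{M,(i)}`. -/
def stalk (W : FunctionFiltration I M) (i : ℕ) (p : M) : Ideal (smoothGerm I p) where
  carrier := {a | ∃ (U : Opens M) (hp : p ∈ U), ∃ g ∈ W.ideal i U, germHom U p hp g = a}
  zero_mem' := ⟨⊤, trivial, 0, zero_mem _, map_zero _⟩
  add_mem' := by
    rintro _ _ ⟨U, hU, g, hg, rfl⟩ ⟨V, hV, h, hh, rfl⟩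
    have hUV : p ∈ U ⊓ V := ⟨hU, hV⟩
    refine ⟨U ⊓ V, hUV, restrict inf_le_left g + restrict inf_le_right h,
      add_mem (W.restrict_mem i _ g hg) (W.restrict_mem i _ h hh), ?_⟩
    rw [map_add, germHom_restrict, germHom_restrict]
  smul_mem' := by
    rintro c _ ⟨U, hU, g, hg, rfl⟩
    obtain ⟨V, hV, h, rfl⟩ := exists_germHom_eq c
    have hUV : p ∈ U ⊓ V := ⟨hU, hV⟩
    refine ⟨U ⊓ V, hUV, restrict inf_le_right h * restrict inf_le_left g,
      Ideal.mul_mem_left _ _ (W.restrict_mem i _ g hg), ?_⟩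
    rw [map_mul, germHom_restrict, germHom_restrict, smul_eq_mul]

variable (W : FunctionFiltration I M) (W' : FunctionFiltration I' M')

theorem germHom_mem_stalk {i : ℕ} {U : Opens M} {g : C^∞⟮I, U; 𝓘(ℝ), ℝ⟯} (hg : g ∈ W.ideal i U)
    {p : M} (hp : p ∈ U) : germHom U p hp g ∈ W.stalk i p := ⟨U, hp, g, hg, rfl⟩

/-- This is the sheaf property: germs in the stalks give local memberships, which `mem_of_locally`
glues. -/
theorem mem_ideal_iff {i : ℕ} {U : Opens M} {g : C^∞⟮I, U; 𝓘(ℝ), ℝ⟯} :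
    g ∈ W.ideal i U ↔ ∀ p (hp : p ∈ U), germHom U p hp g ∈ W.stalk i p := by
  refine ⟨fun h p hp => W.germHom_mem_stalk h hp, fun h => W.mem_of_locally i U g fun p hp => ?_⟩
  obtain ⟨V, hV, g', hg', heq⟩ := h p hp
  obtain ⟨O, hOV, hOU, hpO, he⟩ := (germHom_eq_iff _ _ _ _).1 heq
  exact ⟨O, hOU, hpO, he ▸ W.restrict_mem i hOV g' hg'⟩

theorem stalk_zero (p : M) : W.stalk 0 p = ⊤ := by
  refine (Ideal.eq_top_iff_one _).2 ⟨⊤, trivial, 1, ?_, map_one _⟩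
  rw [W.ideal_zero]; trivial

theorem stalk_antitone (p : M) : Antitone fun i => W.stalk i p := by
  rintro i j hij _ ⟨U, hU, g, hg, rfl⟩
  exact ⟨U, hU, g, W.antitone U hij hg, rfl⟩

theorem mul_mem_stalk {i j : ℕ} {p : M} {a b : smoothGerm I p} (ha : a ∈ W.stalk i p)
    (hb : b ∈ W.stalk j p) : a * b ∈ W.stalk (i + j) p := by
  obtain ⟨U, hU, g, hg, rfl⟩ := ha
  obtain ⟨V, hV, h, hh, rfl⟩ := hb
  have hUV : p ∈ U ⊓ V := ⟨hU, hV⟩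
  refine ⟨U ⊓ V, hUV, restrict inf_le_left g * restrict inf_le_right h,
    W.mul_le _ _ _ (Ideal.mul_mem_mul (W.restrict_mem i _ g hg) (W.restrict_mem j _ h hh)), ?_⟩
  rw [map_mul, germHom_restrict, germHom_restrict]

theorem mem_locus_iff {p : M} : p ∈ W.locus ↔ ∃ i, W.stalk i p ≠ ⊤ := by
  refine exists_congr fun i => ⟨fun h htop => ?_, fun h U hp htop => h ?_⟩
  · obtain ⟨U, hU, g, hg, h1⟩ := (Ideal.eq_top_iff_one _).1 htop
    obtain ⟨O, hOU, hOU', hpO, he⟩ :=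
      (germHom_eq_iff hU hU g 1).1 (h1.trans (map_one _).symm)
    refine h O hpO ((Ideal.eq_top_iff_one _).2 ?_)
    have := W.restrict_mem i hOU g hg
    rwa [he, map_one] at this
  · refine (Ideal.eq_top_iff_one _).2 ⟨U, hp, 1, ?_, map_one _⟩
    rw [htop]; trivial

theorem stalk_eq_top {p : M} (hp : p ∉ W.locus) (i : ℕ) : W.stalk i p = ⊤ := by
  by_contra h
  exact hp (W.mem_locus_iff.2 ⟨i, h⟩)

/-- A germ of positive degree with nonzero value would be a unit, so `1` would have degree 1. Its
powers would then put `1` in every degree, making all stalks trivial at `p`. -/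
theorem germEval_eq_zero {p : M} (hp : p ∈ W.locus) {i : ℕ} (hi : i ≠ 0) {a : smoothGerm I p}
    (ha : a ∈ W.stalk i p) : germEval I p a = 0 := by
  by_contra hne
  obtain ⟨j, hj⟩ := W.mem_locus_iff.1 hp
  have h1 : (1 : smoothGerm I p) ∈ W.stalk 1 p :=
    W.stalk_antitone p (Nat.one_le_iff_ne_zero.2 hi) ((Ideal.eq_top_iff_one _).1
      (Ideal.eq_top_of_isUnit_mem _ ha (isUnit_of_germEval_ne_zero hne)))
  refine hj ((Ideal.eq_top_iff_one _).2 ?_)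
  clear hj
  induction j with
  | zero => rw [stalk_zero]; trivial
  | succ j ih => simpa using W.mul_mem_stalk ih h1

theorem isWeightedMorphism_iff (f : C^∞⟮I, M; I', M'⟯) :
    W.IsWeightedMorphism W' f ↔
      ∀ (p : M) (i : ℕ), ∀ a ∈ W'.stalk i (f p), germPullback f rfl a ∈ W.stalk i p := by
  constructor
  · rintro h p i _ ⟨V, hV, g, hg, rfl⟩
    rw [germPullback_germHom f rfl (U := Opens.comap ⟨f, f.contMDiff.continuous⟩ V)
      (fun _ hx => hx) hV]
    exact W.germHom_mem_stalk (h i V g hg) _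
  · intro h i V g hg
    refine W.mem_ideal_iff.2 fun p hp => ?_
    rw [← germPullback_germHom f rfl (fun _ hx => hx) hp hp]
    exact h p i _ (W'.germHom_mem_stalk hg hp)

section Extension

variable [FiniteDimensional ℝ E] [IsManifold I ∞ M] [T2Space M]

/-- Every germ of filtration degree `i` is the germ of a global function of degree `i`. -/
theorem exists_globalFunctions {i : ℕ} {p : M} {a : smoothGerm I p} (ha : a ∈ W.stalk i p) :
    ∃ g ∈ W.globalFunctions i, ∃ h : SmoothNear I p g, h.germ = a := by
  obtain ⟨U, hU, g, hg, rfl⟩ := ha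
  -- Multiply by a bump function supported in `U` and equal to 1 near `p`. The product is a multiple
  -- of `g` on the support and has zero germ off it, so its degree survives everywhere.
  obtain ⟨ψ, -, hψ⟩ := (SmoothBumpFunction.nhds_basis_tsupport (I := I) p).mem_iff.1
    (U.2.mem_nhds hU)
  have hs : ContMDiff I 𝓘(ℝ) ∞ fun q => ψ q * extend g q := by
    refine contMDiff_of_tsupport fun q hq => ?_
    exact ψ.contMDiffAt.mul (contMDiffAt_extend g (hψ (tsupport_smul_subset_left ψ _ hq)))
  have hn : ∀ q : M, SmoothNear I q fun q => ψ q * extend g q := fun q =>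
    Eventually.of_forall fun x => hs.contMDiffAt
  refine ⟨⟨_, hs⟩, ?_, hn p, ?_⟩
  · refine W.mem_ideal_iff.2 fun q hq => ?_
    have hr : germHom ⊤ q hq (restrictTo ⊤ (fun q => ψ q * extend g q) fun q _ => hs.contMDiffAt)
      ∈ W.stalk i q := by
      rw [germHom_restrictTo _ _ (hn q)]
      by_cases hqs : q ∈ tsupport ψ
      · have hψn : SmoothNear I q ψ := Eventually.of_forall fun x => ψ.contMDiffAt
        exact Ideal.mul_mem_left _ hψn.germ (W.germHom_mem_stalk hg (hψ hqs))
      · have : (hn q).germ = 0 := by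
          refine Subtype.ext (Germ.coe_eq.2 ?_)
          filter_upwards [notMem_tsupport_iff_eventuallyEq.1 hqs] with x hx
          simp [hx]
        rw [this]; exact zero_mem _
    exact hr
  · refine (SmoothNear.germ_eq_iff (hn p) (smoothNear_extend g hU)).2 ?_
    filter_upwards [ψ.eventuallyEq_one] with x hx
    simp [hx]

/-- The definition tests only global functions; cutting off by bump functions makes this the same as
testing all germs. -/
theorem mem_tangentFiltration_iff {i : ℕ} {p : M} {v : TangentSpace I p} :
    v ∈ W.tangentFiltration i p ↔ ∀ a ∈ W.stalk (i + 1) p, germDiff I a v = 0 := by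
  constructor
  · intro hv a ha
    obtain ⟨g, hg, hgn, rfl⟩ := W.exists_globalFunctions ha
    rw [germDiff_germ]
    exact hv _ (Submodule.subset_span ⟨g, hg, rfl⟩)
  · intro h α hα
    induction hα using Submodule.span_induction with
    | mem α hα =>
      obtain ⟨g, hg, rfl⟩ := hα
      have hn : SmoothNear I p g := Eventually.of_forall fun x => g.contMDiff.contMDiffAt
      rw [← germDiff_germ hn]
      refine h _ ⟨⊤, trivial, _, hg, ?_⟩
      exact germHom_restrictTo (U := ⊤) (g := g) (fun q _ => g.contMDiff.contMDiffAt) trivial hn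
    | zero => rfl
    | add α β _ _ hα hβ => rw [add_apply, hα, hβ, add_zero]
    | smul c α _ hα => rw [smul_apply, hα, smul_zero]

/-- A covector which annihilates `(T_pM)_{(-i)}` is the differential of a germ of degree
`i + 1`. -/
theorem exists_germDiff_eq {i : ℕ} {p : M} {a : smoothGerm I p}
    (ha : ∀ v ∈ W.tangentFiltration i p, germDiff I a v = 0) :
    ∃ b ∈ W.stalk (i + 1) p, germDiff I b = germDiff I a := by
  have : FiniteDimensional ℝ (TangentSpace I p) := inferInstanceAs (FiniteDimensional ℝ E)
  let L : W.stalk (i + 1) p → TangentSpace I p →ₗ[ℝ] ℝ := fun b => (germDiff I b.1).toLinearMap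
  -- Double annihilator in finite dimension: the common kernel of the differentials of degree `i +
  -- 1` is `(T_pM)_{(-i)}`.
  have hK : (germDiff I a).toLinearMap ∈ Submodule.span ℝ (range L) := by
    refine FiniteDimensional.mem_span_of_iInf_ker_le_ker fun v hv => ?_
    rw [Submodule.mem_iInf] at hv
    exact ha v (W.mem_tangentFiltration_iff.2 fun b hb => hv ⟨b, hb⟩)
  -- The span adds nothing: the stalk is closed under sums and under multiplication by constant
  -- germs.
  have key : ∀ α ∈ Submodule.span ℝ (range L),
      ∃ b ∈ W.stalk (i + 1) p, (germDiff I b).toLinearMap = α := by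
    intro α hα
    induction hα using Submodule.span_induction with
    | mem α hα => obtain ⟨b, rfl⟩ := hα; exact ⟨b.1, b.2, rfl⟩
    | zero => exact ⟨0, zero_mem _, LinearMap.ext fun v => map_zero (germDeriv I v)⟩
    | add α β _ _ hα hβ =>
      obtain ⟨b, hb, rfl⟩ := hα
      obtain ⟨c, hc, rfl⟩ := hβ
      exact ⟨b + c, add_mem hb hc, by rw [germDiff_add]; rfl⟩
    | smul c α _ hα =>
      obtain ⟨b, hb, rfl⟩ := hα
      refine ⟨constGerm I p c * b, Ideal.mul_mem_left _ _ hb, LinearMap.ext fun v => ?_⟩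
      change germDiff I (constGerm I p c * b) v = c * germDiff I b v
      rw [germDiff_mul, germDiff_constGerm, germEval_constGerm]
      simp
  obtain ⟨b, hb, he⟩ := key _ hK
  exact ⟨b, hb, ContinuousLinearMap.coe_injective he⟩

end Extension

theorem germFst_mul_germSnd {z : M' × M} {V : Opens M'} {U : Opens M}
    (hz : z ∈ openProd V U) (g' : C^∞⟮I', V; 𝓘(ℝ), ℝ⟯) (g : C^∞⟮I, U; 𝓘(ℝ), ℝ⟯) :
    germFst z (germHom V z.1 hz.1 g') *
      germSnd z (germHom U z.2 hz.2 g) =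
    germHom (openProd V U) z hz
      (pullback ContMDiffMap.fst (openProd V U) V (fun _ hz => hz.1) g' *
        pullback ContMDiffMap.snd (openProd V U) U (fun _ hz => hz.2) g) := by
  have h₁ : ∀ x ∈ openProd V U, (ContMDiffMap.fst : C^∞⟮I'.prod I, M' × M; I', M'⟯) x ∈ V :=
    fun x hx => hx.1
  have h₂ : ∀ x ∈ openProd V U, (ContMDiffMap.snd : C^∞⟮I'.prod I, M' × M; I, M⟯) x ∈ U :=
    fun x hx => hx.2
  rw [map_mul]
  exact congrArg₂ (· * ·) (germPullback_germHom ContMDiffMap.fst rfl h₁ hz hz.1 g')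
    (germPullback_germHom ContMDiffMap.snd rfl h₂ hz hz.2 g)

/-- The product filtration is defined by local membership in box ideals, so passing to germs leaves
just their generators. -/
theorem stalk_prod (i : ℕ) (z : M' × M) :
    (W'.prod W).stalk i z = Ideal.span {c | ∃ j k, j + k = i ∧ ∃ a ∈ W'.stalk j z.1,
      ∃ b ∈ W.stalk k z.2, c = germFst z a *
        germSnd z b} := by
  apply le_antisymm
  · rintro _ ⟨O, hO, g, hg, rfl⟩
    obtain ⟨V, U, hVU, hz, hm⟩ := hg z hO
    rw [← germHom_restrict hVU hz]
    have := Ideal.mem_map_of_mem (germHom (openProd V U) z hz) hm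
    unfold boxIdeal at this
    rw [Ideal.map_span] at this
    refine Ideal.span_mono ?_ this
    rintro _ ⟨_, ⟨j, k, hjk, g', hg', g, hg, rfl⟩, rfl⟩
    refine ⟨j, k, hjk, _, W'.germHom_mem_stalk hg' hz.1, _, W.germHom_mem_stalk hg hz.2, ?_⟩
    exact (germFst_mul_germSnd hz g' g).symm
  · refine Ideal.span_le.2 ?_
    rintro _ ⟨j, k, hjk, _, ⟨V, hV, g', hg', rfl⟩, _, ⟨U, hU, g, hg, rfl⟩, rfl⟩
    have hz : z ∈ openProd V U := ⟨hV, hU⟩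
    refine (germFst_mul_germSnd hz g' g).symm ▸ ?_
    refine germHom_mem_stalk _ ?_ hz
    exact fun x hx => ⟨V, U, le_rfl, hx,
      Ideal.subset_span ⟨j, k, hjk, g', hg', g, hg, rfl⟩⟩

end FunctionFiltration

/-! ### Ideals generated by monomials of bounded weighted degree. -/

section MonomialSpan

variable {A B ι : Type*} [CommRing A] [CommRing B]

section

variable [Fintype ι]

/-- The ideal generated by the monomials in `z` of weighted degree at least `i`. -/
def monomialSpan (z : ι → A) (w : ι → ℕ) (i : ℕ) : Ideal A :=
  Ideal.span {a | ∃ s : ι → ℕ, i ≤ ∑ c, w c * s c ∧ a = ∏ c, z c ^ s c}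

theorem prod_mem_monomialSpan (z : ι → A) {w : ι → ℕ} {i : ℕ} {s : ι → ℕ}
    (h : i ≤ ∑ c, w c * s c) : ∏ c, z c ^ s c ∈ monomialSpan z w i :=
  Ideal.subset_span ⟨s, h, rfl⟩

theorem self_mem_monomialSpan (z : ι → A) (w : ι → ℕ) (c : ι) :
    z c ∈ monomialSpan z w (w c) := by
  classical
  refine Ideal.subset_span ⟨Pi.single c 1, ?_, ?_⟩
  · rw [Finset.sum_eq_single c] <;> simp +contextual
  · rw [Finset.prod_eq_single c] <;> simp +contextual

theorem monomialSpan_zero (z : ι → A) (w : ι → ℕ) : monomialSpan z w 0 = ⊤ :=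
  (Ideal.eq_top_iff_one _).2 (Ideal.subset_span ⟨0, by simp, by simp⟩)

theorem monomialSpan_antitone (z : ι → A) (w : ι → ℕ) : Antitone (monomialSpan z w) := by
  intro i j hij
  refine Ideal.span_mono ?_
  rintro _ ⟨s, hs, rfl⟩
  exact ⟨s, hij.trans hs, rfl⟩

theorem mul_mem_monomialSpan {z : ι → A} {w : ι → ℕ} {i j : ℕ} {a b : A}
    (ha : a ∈ monomialSpan z w i) (hb : b ∈ monomialSpan z w j) :
    a * b ∈ monomialSpan z w (i + j) := by
  have : monomialSpan z w i * monomialSpan z w j ≤ monomialSpan z w (i + j) := by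
    unfold monomialSpan
    rw [Ideal.span_mul_span']
    refine Ideal.span_mono ?_
    rintro _ ⟨_, ⟨s, hs, rfl⟩, _, ⟨t, ht, rfl⟩, rfl⟩
    refine ⟨s + t, ?_, ?_⟩
    · simp only [Pi.add_apply, mul_add, Finset.sum_add_distrib]; omega
    · simp only [Pi.add_apply, pow_add, Finset.prod_mul_distrib]
  exact this (Ideal.mul_mem_mul ha hb)

end

theorem pow_mem_of_mul_mem {G : ℕ → Ideal A} (h0 : G 0 = ⊤)
    (hmul : ∀ i j a b, a ∈ G i → b ∈ G j → a * b ∈ G (i + j)) {a : A} {i : ℕ} (ha : a ∈ G i)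
    (n : ℕ) : a ^ n ∈ G (i * n) := by
  induction n with
  | zero => rw [Nat.mul_zero, h0]; trivial
  | succ n ih => rw [pow_succ, Nat.mul_succ]; exact hmul _ _ _ _ ih ha

/-- Products of powers of elements of a multiplicative filtration. -/
theorem prod_pow_mem_of_mul_mem {G : ℕ → Ideal A} (h0 : G 0 = ⊤)
    (hmul : ∀ i j a b, a ∈ G i → b ∈ G j → a * b ∈ G (i + j)) {z : ι → A} {w s : ι → ℕ}
    (t : Finset ι) (hz : ∀ c ∈ t, s c ≠ 0 → z c ∈ G (w c)) :
    ∏ c ∈ t, z c ^ s c ∈ G (∑ c ∈ t, w c * s c) := by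
  classical
  induction t using Finset.induction_on with
  | empty => rw [Finset.sum_empty, h0]; trivial
  | insert c t hc ih =>
    rw [Finset.prod_insert hc, Finset.sum_insert hc]
    refine hmul _ _ _ _ ?_ (ih fun d hd => hz d (Finset.mem_insert_of_mem hd))
    by_cases hs : s c = 0
    · rw [hs, Nat.mul_zero, h0]; trivial
    · exact pow_mem_of_mul_mem h0 hmul (hz c (Finset.mem_insert_self c t) hs) _

variable [Fintype ι]

/-- The monomial filtration is the smallest multiplicative one giving each `z c` degree `w c`. Later
comparisons of filtrations thereby reduce to checking the coordinates. -/
theorem monomialSpan_le {z : ι → A} {w : ι → ℕ} {G : ℕ → Ideal A} (h0 : G 0 = ⊤)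
    (hG : Antitone G) (hmul : ∀ i j a b, a ∈ G i → b ∈ G j → a * b ∈ G (i + j))
    (hz : ∀ c, z c ∈ G (w c)) (i : ℕ) : monomialSpan z w i ≤ G i := by
  refine Ideal.span_le.2 ?_
  rintro _ ⟨s, hs, rfl⟩
  exact hG hs (prod_pow_mem_of_mul_mem h0 hmul Finset.univ fun c _ _ => hz c)

theorem map_monomialSpan (φ : A →+* B) (z : ι → A) (w : ι → ℕ) (i : ℕ) :
    (monomialSpan z w i).map φ = monomialSpan (fun c => φ (z c)) w i := by
  unfold monomialSpan
  rw [Ideal.map_span]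
  congr 1
  ext b
  constructor
  · rintro ⟨_, ⟨s, hs, rfl⟩, rfl⟩
    exact ⟨s, hs, by rw [map_prod]; simp only [map_pow]⟩
  · rintro ⟨s, hs, rfl⟩
    exact ⟨_, ⟨s, hs, rfl⟩, by rw [map_prod]; simp only [map_pow]⟩

/-- Finitely many monomials suffice. -/
theorem monomialSpan_eq_span_range (z : ι → A) (w : ι → ℕ) (i : ℕ) :
    monomialSpan z w i = Ideal.span (range fun s : {s : ι → Fin (i + 1) //
      i ≤ ∑ c, w c * (s c : ℕ)} => ∏ c, z c ^ (s.1 c : ℕ)) := by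
  apply le_antisymm
  · refine Ideal.span_le.2 ?_
    rintro _ ⟨s, hs, rfl⟩
    -- Exponents may be truncated at `i`: a variable of positive weight with exponent at least `i`
    -- reaches degree `i` by itself, and otherwise only variables of weight 0 are truncated.
    have hle : i ≤ ∑ c, w c * min (s c) i := by
      by_cases h : ∃ c, w c ≠ 0 ∧ i ≤ s c
      · obtain ⟨c, hc, hi⟩ := h
        refine le_trans ?_ (Finset.single_le_sum (f := fun c => w c * min (s c) i)
          (fun _ _ => Nat.zero_le _) (Finset.mem_univ c))
        simp only [min_eq_right hi]
        exact Nat.le_mul_of_pos_left i (Nat.pos_of_ne_zero hc)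
      · push Not at h
        refine hs.trans (Finset.sum_le_sum fun c _ => ?_)
        by_cases hc : w c = 0
        · simp [hc]
        · rw [min_eq_left (h c hc).le]
    have hs' : ∏ c, z c ^ s c = (∏ c, z c ^ (s c - min (s c) i)) * ∏ c, z c ^ min (s c) i := by
      rw [← Finset.prod_mul_distrib]
      refine Finset.prod_congr rfl fun c _ => ?_
      rw [← pow_add, Nat.sub_add_cancel (min_le_left _ _)]
    rw [hs']
    exact Ideal.mul_mem_left _ _ (Ideal.subset_span
      ⟨⟨fun c => ⟨min (s c) i, by omega⟩, hle⟩, rfl⟩)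
  · refine Ideal.span_le.2 ?_
    rintro _ ⟨s, rfl⟩
    exact prod_mem_monomialSpan z s.2

end MonomialSpan

/-! ### Weighted coordinates characterized on stalks. -/

section Coordinates

variable {E : Type*} [NormedAddCommGroup E] [NormedSpace ℝ E]
  {H : Type*} [TopologicalSpace H] {I : ModelWithCorners ℝ E H}
  {M : Type*} [TopologicalSpace M] [ChartedSpace H M]

theorem exists_germHom_eq_of_finite {ι : Type*} [Finite ι] {p : M} (c : ι → smoothGerm I p) :
    ∃ (U : Opens M) (hp : p ∈ U) (g : ι → C^∞⟮I, U; 𝓘(ℝ), ℝ⟯),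
      ∀ i, germHom U p hp (g i) = c i := by
  choose U hp g hg using fun i => exists_germHom_eq (c i)
  let O : Opens M := ⟨⋂ i, U i, isOpen_iInter_of_finite fun i => (U i).2⟩
  have hO : ∀ i, O ≤ U i := fun i => iInter_subset (fun i => (U i : Set M)) i
  refine ⟨O, mem_iInter.2 hp, fun i => restrict (hO i) (g i), fun i => ?_⟩
  rw [germHom_restrict, hg]

variable [FiniteDimensional ℝ E] [IsManifold I ∞ M] [T2Space M]

namespace LocalCoordinates

/-- The germ at `p` of the coordinate function `x_a`. -/
def germCoord (x : LocalCoordinates I M) {p : M} (hp : p ∈ x.domain)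
    (a : Fin (Module.finrank ℝ E)) : smoothGerm I p := germHom x.domain p hp (x.coord a)

end LocalCoordinates

namespace FunctionFiltration

variable {W : FunctionFiltration I M}

/-- Monomials are known to generate only over the whole coordinate domain, not over smaller open
sets. A germ therefore has to be extended to a global function of the same degree and restricted to
that domain. -/
theorem IsWeightedCoordinates.stalk_eq {x : LocalCoordinates I M}
    {w : Fin (Module.finrank ℝ E) → ℕ} (hx : W.IsWeightedCoordinates x w) {p : M}
    (hp : p ∈ x.domain) (i : ℕ) : W.stalk i p = monomialSpan (x.germCoord hp) w i := by
  have key : (W.ideal i x.domain).map (germHom x.domain p hp) =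
      monomialSpan (x.germCoord hp) w i := by
    rw [hx i]
    exact map_monomialSpan (germHom x.domain p hp) x.coord w i
  rw [← key]
  apply le_antisymm
  · intro a ha
    obtain ⟨g, hg, hgn, rfl⟩ := W.exists_globalFunctions ha
    have hr := W.restrict_mem i (le_top : x.domain ≤ ⊤) _ hg
    have := Ideal.mem_map_of_mem (germHom x.domain p hp) hr
    rw [← germHom_restrictTo (U := x.domain) (fun q _ => g.contMDiff.contMDiffAt) hp hgn]
    exact this
  · exact Ideal.map_le_iff_le_comap.2 fun g hg => W.germHom_mem_stalk hg hp

variable [SecondCountableTopology M]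

/-- Local coefficients are glued by a partition of unity. This needs a fixed finite list of
monomials, whence `monomialSpan_eq_span_range`. -/
theorem isWeightedCoordinates_of_stalk_eq {x : LocalCoordinates I M}
    {w : Fin (Module.finrank ℝ E) → ℕ}
    (h : ∀ p (hp : p ∈ x.domain) i, W.stalk i p = monomialSpan (x.germCoord hp) w i) :
    W.IsWeightedCoordinates x w := by
  intro i
  apply le_antisymm
  · intro g hg
    let S := {s : Fin (Module.finrank ℝ E) → Fin (i + 1) // i ≤ ∑ c, w c * (s c : ℕ)}
    let m : S → C^∞⟮I, x.domain; 𝓘(ℝ), ℝ⟯ := fun s => ∏ c, x.coord c ^ (s.1 c : ℕ)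
    -- The admissible coefficient vectors at each point form an affine, hence convex, set, as gluing
    -- of smooth local sections requires.
    let t : x.domain → Set (S → ℝ) := fun q => {k | ∑ s, k s * m s q = g q}
    have : LocallyCompactSpace M := Manifold.locallyCompact_of_finiteDimensional I
    have : LocallyCompactSpace x.domain := x.domain.2.locallyCompactSpace
    have hloc : ∀ q : x.domain, ∃ U ∈ 𝓝 q, ∃ k : x.domain → S → ℝ,
        ContMDiffOn I 𝓘(ℝ, S → ℝ) ∞ k U ∧ ∀ y ∈ U, k y ∈ t y := by
      intro q
      have hq := W.germHom_mem_stalk hg q.2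
      rw [h q q.2 i, monomialSpan_eq_span_range, Ideal.mem_span_range_iff_exists_fun] at hq
      obtain ⟨c, hc⟩ := hq
      obtain ⟨U, hqU, k, hk⟩ := exists_germHom_eq_of_finite c
      have hqO : q.1 ∈ x.domain ⊓ U := ⟨q.2, hqU⟩
      have he : germHom (x.domain ⊓ U) q.1 hqO
          (∑ s, restrict inf_le_right (k s) * restrict inf_le_left (m s)) =
          germHom x.domain q.1 q.2 g := by
        rw [← hc, map_sum]
        refine Finset.sum_congr rfl fun s _ => ?_
        rw [map_mul, germHom_restrict, germHom_restrict, hk, map_prod]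
        simp only [map_pow]
        rfl
      obtain ⟨O, hO, hO', hqO', heq⟩ := (germHom_eq_iff _ _ _ _).1 he
      refine ⟨Subtype.val ⁻¹' (O : Set M), (O.2.preimage continuous_subtype_val).mem_nhds hqO',
        fun y s => extend (k s) y, ?_, ?_⟩
      · refine contMDiffOn_pi_space.2 fun s y hy => ?_
        exact (contMDiffAt_subtype_iff.2
          (contMDiffAt_extend (k s) (hO hy).2)).contMDiffWithinAt
      · intro y hy
        have := DFunLike.congr_fun heq ⟨y.1, hy⟩
        change ∑ s, extend (k s) y * m s y = g y
        change (ContMDiffMap.coeFnRingHom (restrict hO _)) _ = g y at this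
        rw [map_sum, map_sum, Finset.sum_apply] at this
        rw [← this]
        refine Finset.sum_congr rfl fun s _ => ?_
        rw [extend_apply _ (hO hy).2]
        rfl
    obtain ⟨k, hk⟩ := exists_contMDiffMap_forall_mem_convex_of_local I (t := t) (n := ⊤)
      (fun q a ha b hb α β _ _ hab => by
        change ∑ s, (α * a s + β * b s) * m s q = g q
        simp only [add_mul, mul_assoc, Finset.sum_add_distrib, ← Finset.mul_sum]
        rw [show ∑ s, a s * m s q = g q from ha, show ∑ s, b s * m s q = g q from hb,
          ← add_mul, hab, one_mul]) hloc
    let k' : S → C^∞⟮I, x.domain; 𝓘(ℝ), ℝ⟯ := fun s =>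
      ⟨fun q => k q s, contMDiff_pi_space.1 k.contMDiff s⟩
    have hg' : g = ∑ s, k' s * m s := by
      ext q
      change g q = (ContMDiffMap.coeFnRingHom (∑ s, _)) q
      rw [map_sum, Finset.sum_apply]
      exact (hk q).symm
    rw [hg']
    exact sum_mem fun s _ => Ideal.mul_mem_left _ _
      (prod_mem_monomialSpan x.coord s.2)
  · refine Ideal.span_le.2 ?_
    rintro _ ⟨s, hs, rfl⟩
    refine W.mem_ideal_iff.2 fun p hp => ?_
    rw [h p hp i, map_prod]
    simp only [map_pow]
    exact prod_mem_monomialSpan (x.germCoord hp) hs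

end FunctionFiltration

end Coordinates

/-! ### The coordinates `(y_b - f^*y_b, x_a)` adapted to the graph. -/

section GraphCoordinates

variable {E : Type*} [NormedAddCommGroup E] [NormedSpace ℝ E]
  {H : Type*} [TopologicalSpace H] {I : ModelWithCorners ℝ E H}
  {M : Type*} [TopologicalSpace M] [ChartedSpace H M]
  {E' : Type*} [NormedAddCommGroup E'] [NormedSpace ℝ E']
  {H' : Type*} [TopologicalSpace H'] {I' : ModelWithCorners ℝ E' H'}
  {M' : Type*} [TopologicalSpace M'] [ChartedSpace H' M']

namespace LocalCoordinates

section OfSmooth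

variable [I.Boundaryless] [IsManifold I ∞ M]

/-- The coordinates given by a smooth parametrized open subset of the model vector space. -/
def ofSmooth (φ : OpenPartialHomeomorph M E) (hφ : ContMDiffOn I 𝓘(ℝ, E) ∞ φ φ.source)
    (hφ' : ContMDiffOn 𝓘(ℝ, E) I ∞ φ.symm φ.target)
    (b : Module.Basis (Fin (Module.finrank ℝ E)) ℝ E) : LocalCoordinates I M where
  chart := φ.trans I.toHomeomorph.symm.toOpenPartialHomeomorph
  chart_mem := by
    refine OpenPartialHomeomorph.mem_maximalAtlas_of_contMDiffOn _ ?_ ?_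
    · have h : ContMDiffOn 𝓘(ℝ, E) I ∞ I.symm univ := I.range_eq_univ ▸ I.contMDiffOn_symm
      exact h.comp (hφ.mono fun q hq => hq.1) fun _ _ => trivial
    · exact hφ'.comp I.contMDiff.contMDiffOn fun q hq => hq.2
  basis := b

variable {φ : OpenPartialHomeomorph M E} {hφ : ContMDiffOn I 𝓘(ℝ, E) ∞ φ φ.source}
    {hφ' : ContMDiffOn 𝓘(ℝ, E) I ∞ φ.symm φ.target}
    {b : Module.Basis (Fin (Module.finrank ℝ E)) ℝ E}

theorem mem_domain_ofSmooth {q : M} : q ∈ (ofSmooth φ hφ hφ' b).domain ↔ q ∈ φ.source :=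
  and_iff_left trivial

theorem coord_ofSmooth (a : Fin (Module.finrank ℝ E)) (q : (ofSmooth φ hφ hφ' b).domain) :
    (ofSmooth φ hφ hφ' b).coord a q = b.repr (φ q) a := by
  change b.repr (I (I.symm (φ q))) a = _
  rw [I.right_inv (I.range_eq_univ ▸ mem_univ _)]

end OfSmooth

theorem contMDiffOn_toFun (x : LocalCoordinates I M) :
    ContMDiffOn I 𝓘(ℝ, E) ∞ (fun q => I (x.chart q)) x.chart.source :=
  I.contMDiff.comp_contMDiffOn (contMDiffOn_of_mem_maximalAtlas x.chart_mem)

theorem contMDiffOn_invFun [I.Boundaryless] (x : LocalCoordinates I M) :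
    ContMDiffOn 𝓘(ℝ, E) I ∞ (fun e => x.chart.symm (I.symm e)) (I.symm ⁻¹' x.chart.target) := by
  have h : ContMDiffOn 𝓘(ℝ, E) I ∞ I.symm univ := I.range_eq_univ ▸ I.contMDiffOn_symm
  exact (contMDiffOn_symm_of_mem_maximalAtlas x.chart_mem).comp (h.mono (subset_univ _))
    fun e he => he

variable (f : C^∞⟮I, M; I', M'⟯) (y : LocalCoordinates I' M') (x : LocalCoordinates I M)

theorem contMDiffOn_comp_toFun : ContMDiffOn I 𝓘(ℝ, E') ∞ (fun q => I' (y.chart (f q)))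
    (x.chart.source ∩ f ⁻¹' y.chart.source) :=
  y.contMDiffOn_toFun.comp (f.contMDiff.contMDiffOn) fun _ h => h.2

/-- The parameter domain of `x`, intersected with the preimage of the domain of `y`. -/
def graphBase : Set (E' × E) :=
  {e | I.symm e.2 ∈ x.chart.target ∧ f (x.chart.symm (I.symm e.2)) ∈ y.chart.source}

theorem isOpen_graphBase : IsOpen (graphBase f y x) := by
  have h1 : IsOpen {e : E' × E | I.symm e.2 ∈ x.chart.target} :=
    x.chart.open_target.preimage (I.continuous_symm.comp continuous_snd)
  have h2 : ContinuousOn (fun e : E' × E => x.chart.symm (I.symm e.2))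
      {e : E' × E | I.symm e.2 ∈ x.chart.target} :=
    x.chart.continuousOn_symm.comp (I.continuous_symm.comp continuous_snd).continuousOn fun _ h => h
  exact h2.isOpen_inter_preimage h1 (y.chart.open_source.preimage f.contMDiff.continuous)

theorem contMDiffOn_graph_toFun : ContMDiffOn (I'.prod I) 𝓘(ℝ, E' × E) ∞
    (fun z : M' × M => (I' (y.chart z.1) - I' (y.chart (f z.2)), I (x.chart z.2)))
    (y.chart.source ×ˢ (x.chart.source ∩ f ⁻¹' y.chart.source)) := by
  refine ContMDiffOn.prodMk_space (ContMDiffOn.sub ?_ ?_) ?_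
  · exact y.contMDiffOn_toFun.comp contMDiff_fst.contMDiffOn fun z hz => hz.1
  · exact (contMDiffOn_comp_toFun f y x).comp contMDiff_snd.contMDiffOn fun z hz => hz.2
  · exact x.contMDiffOn_toFun.comp contMDiff_snd.contMDiffOn fun z hz => hz.2.1

variable [I.Boundaryless]

theorem contMDiffOn_graph_snd : ContMDiffOn 𝓘(ℝ, E' × E) I ∞
    (fun e : E' × E => x.chart.symm (I.symm e.2)) (graphBase f y x) :=
  x.contMDiffOn_invFun.comp (ContinuousLinearMap.snd ℝ E' E).contMDiff.contMDiffOn fun _ h => h.1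

theorem contMDiffOn_graph_fst : ContMDiffOn 𝓘(ℝ, E' × E) 𝓘(ℝ, E') ∞
    (fun e : E' × E => e.1 + I' (y.chart (f (x.chart.symm (I.symm e.2))))) (graphBase f y x) := by
  refine (ContinuousLinearMap.fst ℝ E' E).contMDiff.contMDiffOn.add ?_
  refine (contMDiffOn_comp_toFun f y x).comp (contMDiffOn_graph_snd f y x) fun e he => ?_
  exact ⟨x.chart.map_target he.1, he.2⟩

variable [I'.Boundaryless]

theorem contMDiffOn_graph_invFun : ContMDiffOn 𝓘(ℝ, E' × E) (I'.prod I) ∞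
    (fun e : E' × E => (y.chart.symm (I'.symm
      (e.1 + I' (y.chart (f (x.chart.symm (I.symm e.2)))))), x.chart.symm (I.symm e.2)))
    (graphBase f y x ∩ (fun e : E' × E => e.1 + I' (y.chart (f (x.chart.symm (I.symm e.2))))) ⁻¹'
      (I'.symm ⁻¹' y.chart.target)) := by
  refine ContMDiffOn.prodMk ?_ ((contMDiffOn_graph_snd f y x).mono inter_subset_left)
  exact y.contMDiffOn_invFun.comp ((contMDiffOn_graph_fst f y x).mono inter_subset_left)
    fun e he => he.2

/-- The map `(q', q) ↦ (y(q') - y(f(q)), x(q))`. -/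
def graphHomeomorph : OpenPartialHomeomorph (M' × M) (E' × E) where
  toFun z := (I' (y.chart z.1) - I' (y.chart (f z.2)), I (x.chart z.2))
  invFun e := (y.chart.symm (I'.symm
      (e.1 + I' (y.chart (f (x.chart.symm (I.symm e.2)))))), x.chart.symm (I.symm e.2))
  source := y.chart.source ×ˢ (x.chart.source ∩ f ⁻¹' y.chart.source)
  target := graphBase f y x ∩
    (fun e : E' × E => e.1 + I' (y.chart (f (x.chart.symm (I.symm e.2))))) ⁻¹'
      (I'.symm ⁻¹' y.chart.target)
  map_source' := by
    rintro ⟨q', q⟩ ⟨h', h, hf⟩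
    have hf : f q ∈ y.chart.source := hf
    simp [graphBase, x.chart.left_inv h, x.chart.map_source h, hf, y.chart.map_source h']
  map_target' := by
    rintro ⟨e', e⟩ ⟨⟨h, hf⟩, h'⟩
    exact ⟨y.chart.map_target h', x.chart.map_target h, hf⟩
  left_inv' := by
    rintro ⟨q', q⟩ ⟨h', h, hf⟩
    simp [x.chart.left_inv h, y.chart.left_inv h']
  right_inv' := by
    rintro ⟨e', e⟩ ⟨⟨h, hf⟩, h'⟩
    have h : I.symm e ∈ x.chart.target := h
    have h' : I'.symm (e' + I' (y.chart (f (x.chart.symm (I.symm e))))) ∈ y.chart.target := h'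
    simp [x.chart.right_inv h, y.chart.right_inv h', I'.right_inv, I.right_inv, I.range_eq_univ,
      I'.range_eq_univ]
  open_source := y.chart.open_source.prod
    (x.chart.open_source.inter (y.chart.open_source.preimage f.contMDiff.continuous))
  open_target := (contMDiffOn_graph_fst f y x).continuousOn.isOpen_inter_preimage
    (isOpen_graphBase f y x) (y.chart.open_target.preimage I'.continuous_symm)
  continuousOn_toFun := (contMDiffOn_graph_toFun f y x).continuousOn
  continuousOn_invFun := (contMDiffOn_graph_invFun f y x).continuousOn

variable [FiniteDimensional ℝ E] [FiniteDimensional ℝ E']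

variable (E E') in
/-- Indices of coordinates on a product. -/
def prodIndex : Fin (Module.finrank ℝ E') ⊕ Fin (Module.finrank ℝ E) ≃
    Fin (Module.finrank ℝ (E' × E)) :=
  finSumFinEquiv.trans (finCongr Module.finrank_prod.symm)

variable [IsManifold I ∞ M] [IsManifold I' ∞ M']

/-- The coordinates `(y_b - f^* y_b, x_a)` on the product `M' × M`. -/
def graphCoordinates : LocalCoordinates (I'.prod I) (M' × M) :=
  ofSmooth (graphHomeomorph f y x) (contMDiffOn_graph_toFun f y x) (contMDiffOn_graph_invFun f y x)
    ((y.basis.prod x.basis).reindex (prodIndex E E'))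

theorem mem_domain_graphCoordinates {z : M' × M} : z ∈ (graphCoordinates f y x).domain ↔
    z.1 ∈ y.domain ∧ z.2 ∈ x.domain ∧ f z.2 ∈ y.domain :=
  mem_domain_ofSmooth

theorem coord_graphCoordinates_inl (b : Fin (Module.finrank ℝ E'))
    (z : (graphCoordinates f y x).domain) :
    (graphCoordinates f y x).coord (prodIndex E E' (Sum.inl b)) z =
      y.coord b ⟨z.1.1, z.2.1.1⟩ - y.coord b ⟨f z.1.2, z.2.1.2.2⟩ := by
  refine (coord_ofSmooth _ z).trans ?_
  rw [Module.Basis.repr_reindex_apply, Equiv.symm_apply_apply, Module.Basis.prod_repr_inl]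
  change y.basis.repr (_ - _) b = _
  rw [map_sub]
  rfl

theorem coord_graphCoordinates_inr (a : Fin (Module.finrank ℝ E))
    (z : (graphCoordinates f y x).domain) :
    (graphCoordinates f y x).coord (prodIndex E E' (Sum.inr a)) z =
      x.coord a ⟨z.1.2, z.2.1.2.1⟩ := by
  refine (coord_ofSmooth _ z).trans ?_
  rw [Module.Basis.repr_reindex_apply, Equiv.symm_apply_apply, Module.Basis.prod_repr_inr]
  rfl

/-- The chart of `y` is injective on its source, so the vanishing of all `y_b(q') - y_b(f(q))`
forces `q' = f(q)`. -/
theorem isSubmanifoldCoordinates_graphCoordinates :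
    (graphCoordinates f y x).IsSubmanifoldCoordinates (graph f) := by
  refine ⟨range fun b => prodIndex E E' (Sum.inl b), fun z => ?_⟩
  rw [forall_mem_range]
  simp only [coord_graphCoordinates_inl, sub_eq_zero]
  constructor
  · intro hz b
    have hz : z.1.1 = f z.1.2 := hz
    congr 2
  · intro h
    have h1 : I' (y.chart z.1.1) = I' (y.chart (f z.1.2)) :=
      y.basis.repr.injective (Finsupp.ext h)
    exact y.chart.injOn z.2.1.1 z.2.1.2.2 (I'.injective h1)

end LocalCoordinates

end GraphCoordinates

/-! ### A weighted morphism satisfies (a) and (b). -/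

section MorphismGraph

variable {E : Type*} [NormedAddCommGroup E] [NormedSpace ℝ E]
  {H : Type*} [TopologicalSpace H] {I : ModelWithCorners ℝ E H}
  {M : Type*} [TopologicalSpace M] [ChartedSpace H M]
  {E' : Type*} [NormedAddCommGroup E'] [NormedSpace ℝ E']
  {H' : Type*} [TopologicalSpace H'] {I' : ModelWithCorners ℝ E' H'}
  {M' : Type*} [TopologicalSpace M'] [ChartedSpace H' M']

namespace LocalCoordinates

variable [FiniteDimensional ℝ E] [IsManifold I ∞ M] [FiniteDimensional ℝ E'] [IsManifold I' ∞ M']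
  [I.Boundaryless] [I'.Boundaryless]
  {f : C^∞⟮I, M; I', M'⟯} {y : LocalCoordinates I' M'} {x : LocalCoordinates I M} {z : M' × M}

theorem germCoord_graphCoordinates_inl (hz : z ∈ (graphCoordinates f y x).domain)
    (hy : z.1 ∈ y.domain) (hfy : f z.2 ∈ y.domain) (b : Fin (Module.finrank ℝ E')) :
    (graphCoordinates f y x).germCoord hz (prodIndex E E' (Sum.inl b)) =
      germFst z (y.germCoord hy b) -
      germSnd z (germPullback f rfl (y.germCoord hfy b)) := by
  refine Subtype.ext (Germ.coe_eq.2 ?_)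
  filter_upwards [(graphCoordinates f y x).domain.2.mem_nhds hz] with u hu
  refine ((extend_apply _ hu).trans (coord_graphCoordinates_inl f y x b ⟨u, hu⟩)).trans ?_
  exact (congrArg₂ (· - ·) (extend_apply (y.coord b) hu.1.1)
    (extend_apply (y.coord b) hu.1.2.2)).symm

theorem germCoord_graphCoordinates_inr (hz : z ∈ (graphCoordinates f y x).domain)
    (hx : z.2 ∈ x.domain) (a : Fin (Module.finrank ℝ E)) :
    (graphCoordinates f y x).germCoord hz (prodIndex E E' (Sum.inr a)) =
      germSnd z (x.germCoord hx a) := by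
  refine Subtype.ext (Germ.coe_eq.2 ?_)
  filter_upwards [(graphCoordinates f y x).domain.2.mem_nhds hz] with u hu
  refine ((extend_apply _ hu).trans (coord_graphCoordinates_inr f y x a ⟨u, hu⟩)).trans ?_
  exact (extend_apply (x.coord a) hu.1.2.1).symm

end LocalCoordinates

namespace FunctionFiltration

variable {W : FunctionFiltration I M} {W' : FunctionFiltration I' M'}

theorem germFst_mem_stalk_prod {z : M' × M} {i : ℕ} {a : smoothGerm I' z.1}
    (ha : a ∈ W'.stalk i z.1) :
    germFst z a ∈ (W'.prod W).stalk i z := by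
  rw [stalk_prod]
  refine Ideal.subset_span ⟨i, 0, add_zero i, a, ha, 1, ?_, ?_⟩
  · rw [stalk_zero]; trivial
  · rw [map_one, mul_one]

theorem germSnd_mem_stalk_prod {z : M' × M} {i : ℕ} {a : smoothGerm I z.2}
    (ha : a ∈ W.stalk i z.2) :
    germSnd z a ∈ (W'.prod W).stalk i z := by
  rw [stalk_prod]
  refine Ideal.subset_span ⟨0, i, zero_add i, 1, ?_, a, ha, ?_⟩
  · rw [stalk_zero]; trivial
  · rw [map_one, one_mul]

variable [FiniteDimensional ℝ E] [IsManifold I ∞ M] [T2Space M]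
  [FiniteDimensional ℝ E'] [IsManifold I' ∞ M'] [T2Space M']

/-- Dual to the preservation of degree under pull-back, through `d(f^*a)(v) = da(Tf v)`. -/
theorem IsWeightedMorphism.preservesTangentFiltration {f : C^∞⟮I, M; I', M'⟯}
    (hf : W.IsWeightedMorphism W' f) : W.PreservesTangentFiltration W' f := by
  intro p _ i v hv
  rw [mem_tangentFiltration_iff] at hv ⊢
  intro a ha
  rw [← germDiff_germPullback]
  exact hv _ ((W.isWeightedMorphism_iff W' f).1 hf p _ a ha)

variable [I.Boundaryless] [I'.Boundaryless] [SecondCountableTopology M]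
  [SecondCountableTopology M']

open LocalCoordinates

/-- The change from `y_b` to `y_b - f^*y_b` is a shear by functions of the same weight `w'_b`. It
therefore preserves the filtration in both directions. -/
theorem IsWeightedMorphism.isWeightedCoordinates_graphCoordinates {f : C^∞⟮I, M; I', M'⟯}
    (hf : W.IsWeightedMorphism W' f) {y : LocalCoordinates I' M'}
    {w' : Fin (Module.finrank ℝ E') → ℕ} (hy : W'.IsWeightedCoordinates y w')
    {x : LocalCoordinates I M} {w : Fin (Module.finrank ℝ E) → ℕ}
    (hx : W.IsWeightedCoordinates x w) :
    (W'.prod W).IsWeightedCoordinates (graphCoordinates f y x)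
      (fun c => Sum.elim w' w ((prodIndex E E').symm c)) := by
  rw [W.isWeightedMorphism_iff W' f] at hf
  refine isWeightedCoordinates_of_stalk_eq fun z hz i => ?_
  obtain ⟨hz1, hz2, hzf⟩ := (mem_domain_graphCoordinates f y x).1 hz
  set u : Fin (Module.finrank ℝ (E' × E)) → ℕ :=
    fun c => Sum.elim w' w ((prodIndex E E').symm c) with hu
  set F := monomialSpan ((graphCoordinates f y x).germCoord hz) u with hF
  have hul : ∀ b, u (prodIndex E E' (Sum.inl b)) = w' b := fun b => by simp [hu]
  have hur : ∀ a, u (prodIndex E E' (Sum.inr a)) = w a := fun a => by simp [hu]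
  have hycoord : ∀ b, y.germCoord hzf b ∈ W'.stalk (w' b) (f z.2) := fun b => by
    rw [hy.stalk_eq hzf]; exact self_mem_monomialSpan _ _ b
  have hsnd : ∀ k, ∀ b ∈ W.stalk k z.2,
      germSnd z b ∈ F k := by
    intro k b hb
    rw [hx.stalk_eq hz2] at hb
    refine monomialSpan_le (G := fun k => (F k).comap (germSnd z)) ?_ (fun i j hij => Ideal.comap_mono (monomialSpan_antitone _ _ hij))
      (fun i j a b ha hb => ?_) (fun a => ?_) k hb
    · simp only [hF, monomialSpan_zero]; rfl
    · rw [Ideal.mem_comap, map_mul]; exact mul_mem_monomialSpan ha hb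
    · rw [Ideal.mem_comap, ← germCoord_graphCoordinates_inr hz hz2, ← hur]
      exact self_mem_monomialSpan _ _ _
  have hfst : ∀ k, ∀ b ∈ W'.stalk k z.1,
      germFst z b ∈ F k := by
    intro k b hb
    rw [hy.stalk_eq hz1] at hb
    refine monomialSpan_le (G := fun k => (F k).comap (germFst z)) ?_ (fun i j hij => Ideal.comap_mono (monomialSpan_antitone _ _ hij))
      (fun i j a b ha hb => ?_) (fun a => ?_) k hb
    · simp only [hF, monomialSpan_zero]; rfl
    · rw [Ideal.mem_comap, map_mul]; exact mul_mem_monomialSpan ha hb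
    -- Write `y_b = (y_b - f^*y_b) + f^*y_b`. The second term comes from `M` and has degree `w'_b`
    -- there, so `hsnd` applies to it.
    · rw [Ideal.mem_comap, ← sub_add_cancel (germFst z
        (y.germCoord hz1 a)) (germSnd z
        (germPullback f rfl (y.germCoord hzf a))), ← germCoord_graphCoordinates_inl hz hz1 hzf]
      refine add_mem ?_ (hsnd _ _ (hf _ _ _ (hycoord a)))
      rw [← hul]
      exact self_mem_monomialSpan _ _ _
  apply le_antisymm
  · rw [stalk_prod]
    refine Ideal.span_le.2 ?_
    rintro _ ⟨j, k, rfl, a, ha, b, hb, rfl⟩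
    exact mul_mem_monomialSpan (hfst j a ha) (hsnd k b hb)
  · refine monomialSpan_le (G := fun k => (W'.prod W).stalk k z) (stalk_zero _ _)
      (stalk_antitone _ _) (fun i j a b ha hb => mul_mem_stalk _ ha hb) (fun c => ?_) i
    obtain ⟨c | c, rfl⟩ := (prodIndex E E').surjective c
    · rw [germCoord_graphCoordinates_inl hz hz1 hzf, hul]
      refine sub_mem (germFst_mem_stalk_prod ?_)
        (germSnd_mem_stalk_prod (hf _ _ _ (hycoord c)))
      rw [hy.stalk_eq hz1]; exact self_mem_monomialSpan _ _ c
    · rw [germCoord_graphCoordinates_inr hz hz2, hur]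
      refine germSnd_mem_stalk_prod ?_
      rw [hx.stalk_eq hz2]; exact self_mem_monomialSpan _ _ c

theorem IsWeightedMorphism.isWeightedSubmanifold_graph (hW : W.IsWeighting) (hW' : W'.IsWeighting)
    {f : C^∞⟮I, M; I', M'⟯} (hf : W.IsWeightedMorphism W' f) :
    (W'.prod W).IsWeightedSubmanifold (graph f) := by
  have key : ∀ z ∈ graph f, ∃ (c : LocalCoordinates (I'.prod I) (M' × M))
      (u : Fin (Module.finrank ℝ (E' × E)) → ℕ), z ∈ c.domain ∧
      (W'.prod W).IsWeightedCoordinates c u ∧ c.IsSubmanifoldCoordinates (graph f) := by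
    rintro ⟨q, p⟩ (rfl : q = f p)
    obtain ⟨x, w, hp, hx⟩ := hW p
    obtain ⟨y, w', hq, hy⟩ := hW' (f p)
    exact ⟨_, _, (mem_domain_graphCoordinates f y x).2 ⟨hq, hp, hq⟩,
      hf.isWeightedCoordinates_graphCoordinates hy hx,
      isSubmanifoldCoordinates_graphCoordinates f y x⟩
  refine ⟨fun z hz => ?_, fun z hz => key z hz.1⟩
  obtain ⟨c, _, h1, _, h2⟩ := key z hz
  exact ⟨c, h1, h2⟩

end FunctionFiltration

end MorphismGraph

/-! ### Comparing a filtration with a larger monomial filtration. -/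

section MonomialEval

variable {E : Type*} [NormedAddCommGroup E] [NormedSpace ℝ E]
  {H : Type*} [TopologicalSpace H] {I : ModelWithCorners ℝ E H}
  {M : Type*} [TopologicalSpace M] [ChartedSpace H M]
  {ι : Type*} [Fintype ι] {p : M} {r : ι → smoothGerm I p} {u : ι → ℕ}

theorem exists_ne_zero_of_sum_ne_zero {s : ι → ℕ} (hs : ∑ c, u c * s c ≠ 0) :
    ∃ c, u c ≠ 0 ∧ s c ≠ 0 := by
  obtain ⟨c, -, hc⟩ := Finset.exists_ne_zero_of_sum_ne_zero hs
  exact ⟨c, left_ne_zero_of_mul hc, right_ne_zero_of_mul hc⟩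

theorem germEval_monomial (hr : ∀ c, u c ≠ 0 → germEval I p (r c) = 0) {s : ι → ℕ}
    (hs : ∑ c, u c * s c ≠ 0) : germEval I p (∏ c, r c ^ s c) = 0 := by
  obtain ⟨c, hu, hc⟩ := exists_ne_zero_of_sum_ne_zero hs
  rw [map_prod]
  exact Finset.prod_eq_zero (Finset.mem_univ c) (by rw [map_pow, hr c hu, zero_pow hc])

theorem monomial_eq_mul [DecidableEq ι] {c : ι} {s : ι → ℕ} (hc : s c ≠ 0) :
    ∏ d, r d ^ s d = r c * ∏ d, r d ^ (s d - if d = c then 1 else 0) := by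
  rw [← Finset.mul_prod_erase _ _ (Finset.mem_univ c),
    ← Finset.mul_prod_erase _ (fun d => r d ^ (s d - if d = c then 1 else 0)) (Finset.mem_univ c),
    if_pos rfl, ← mul_assoc, mul_pow_sub_one hc]
  congr 1
  refine Finset.prod_congr rfl fun d hd => ?_
  rw [if_neg (Finset.ne_of_mem_erase hd), Nat.sub_zero]

theorem sum_eq_add [DecidableEq ι] {c : ι} {s : ι → ℕ} (hc : s c ≠ 0) :
    ∑ d, u d * s d = u c + ∑ d, u d * (s d - if d = c then 1 else 0) := by
  rw [← Finset.add_sum_erase _ _ (Finset.mem_univ c),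
    ← Finset.add_sum_erase _ (fun d => u d * (s d - if d = c then 1 else 0)) (Finset.mem_univ c),
    if_pos rfl, ← add_assoc]
  congr 1
  · obtain ⟨n, hn⟩ := Nat.exists_eq_succ_of_ne_zero hc
    simp only [hn, Nat.succ_eq_add_one, Nat.add_sub_cancel]; ring
  · refine Finset.sum_congr rfl fun d hd => ?_
    rw [if_neg (Finset.ne_of_mem_erase hd), Nat.sub_zero]

namespace FunctionFiltration

variable (W : FunctionFiltration I M)

/-- An element of filtration degree `k` is, up to an element of the `k`-th ideal of `W` with
vanishing `1`-jet, a linear combination of the `r_c` of weight at least `k`. -/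
theorem exists_linear_part (hr : ∀ c, u c ≠ 0 → germEval I p (r c) = 0) {k : ℕ} (hk : k ≠ 0)
    (ih : ∀ c, u c < k → r c ∈ W.stalk (u c) p) {a : smoothGerm I p}
    (ha : a ∈ monomialSpan r u k) [Fintype {c // k ≤ u c ∧ r c ≠ 0}] :
    ∃ h : {c // k ≤ u c ∧ r c ≠ 0} → smoothGerm I p, ∃ e ∈ W.stalk k p,
      germEval I p e = 0 ∧ (∀ v, germDiff I e v = 0) ∧ a = ∑ c, h c * r c.1 + e := by
  classical
  have h0 : ∀ v : TangentSpace I p, germDiff I (0 : smoothGerm I p) v = 0 :=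
    fun v => map_zero (germDeriv I v)
  unfold monomialSpan at ha
  induction ha using Submodule.span_induction with
  | zero => exact ⟨0, 0, zero_mem _, map_zero _, h0, by simp⟩
  | add a b _ _ ha hb =>
    obtain ⟨h, e, he, hev, hd, rfl⟩ := ha
    obtain ⟨h', e', he', hev', hd', rfl⟩ := hb
    refine ⟨h + h', e + e', add_mem he he', by rw [map_add, hev, hev', add_zero], fun v => ?_, ?_⟩
    · rw [germDiff_add, add_apply, hd, hd', add_zero]
    · simp only [Pi.add_apply, add_mul, Finset.sum_add_distrib]; ring
  | smul c a _ ha =>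
    obtain ⟨h, e, he, hev, hd, rfl⟩ := ha
    refine ⟨fun d => c * h d, c * e, Ideal.mul_mem_left _ _ he, by rw [map_mul, hev, mul_zero],
      fun v => ?_, ?_⟩
    · rw [germDiff_mul, hd, hev, mul_zero, zero_mul, add_zero]
    · rw [smul_eq_mul, mul_add, Finset.mul_sum]; simp only [mul_assoc]
  | mem a ha =>
    obtain ⟨s, hs, rfl⟩ := ha
    -- A factor of weight at least `k` gives a linear term, with the rest of the monomial as
    -- coefficient. Otherwise every factor has weight below `k`, and the monomial goes into the
    -- remainder.
    by_cases h : ∃ c, s c ≠ 0 ∧ k ≤ u c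
    · obtain ⟨c, hc, hkc⟩ := h
      rw [monomial_eq_mul hc]
      by_cases hrc : r c = 0
      · exact ⟨0, 0, zero_mem _, map_zero _, h0, by simp [hrc]⟩
      · refine ⟨Pi.single ⟨c, hkc, hrc⟩ (∏ d, r d ^ (s d - if d = c then 1 else 0)), 0,
          zero_mem _, map_zero _, h0, ?_⟩
        rw [Finset.sum_eq_single ⟨c, hkc, hrc⟩]
        · rw [Pi.single_eq_same, add_zero, mul_comm]
        · intro d _ hd; rw [Pi.single_eq_of_ne hd, zero_mul]
        · intro hn; exact absurd (Finset.mem_univ _) hn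
    · push Not at h
      refine ⟨0, _, W.stalk_antitone p hs (prod_pow_mem_of_mul_mem (G := fun j => W.stalk j p)
        (W.stalk_zero p) (fun i j a b => W.mul_mem_stalk) Finset.univ
        fun c _ hc => ih c (h c hc)), germEval_monomial hr (by omega), fun v => ?_, by simp⟩
      -- Split off a factor with `0 < u c < k`. The total weight is at least `k`, so the cofactor
      -- still has positive weight; both vanish at `p`, and the product rule kills the differential.
      obtain ⟨c, hu, hc⟩ := exists_ne_zero_of_sum_ne_zero (u := u) (s := s) (by omega)
      rw [sum_eq_add hc] at hs
      have hlt := h c hc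
      rw [monomial_eq_mul hc, germDiff_mul, germEval_monomial hr (by omega), hr c hu]
      ring

variable [FiniteDimensional ℝ E] [IsManifold I ∞ M] [T2Space M]

/-- A comparison of weightings with the same induced filtration of the tangent space. -/
theorem mem_stalk_of_stalk_le_monomialSpan
    (hspan : ∀ k, W.stalk k p ≤ monomialSpan r u k)
    (hr : ∀ c, u c ≠ 0 → germEval I p (r c) = 0)
    (hT : ∀ k c, k + 1 ≤ u c → ∀ v ∈ W.tangentFiltration k p, germDiff I (r c) v = 0)
    (hdual : ∀ c, r c ≠ 0 → ∃ v, germDiff I (r c) v = 1 ∧ ∀ d, d ≠ c → germDiff I (r d) v = 0)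
    (c : ι) : r c ∈ W.stalk (u c) p := by
  classical
  -- Raise the degree one step at a time for all variables of sufficient weight, so that variables
  -- of weight below `k` are already settled at step `k`.
  suffices h : ∀ k c, k ≤ u c → r c ∈ W.stalk k p from h _ c le_rfl
  intro k
  induction k using Nat.strong_induction_on with
  | _ k ih =>
    rcases k with _ | k
    · intro c _; rw [stalk_zero]; trivial
    let Q := {c // k + 1 ≤ u c ∧ r c ≠ 0}
    have hQ0 : ∀ c : Q, germEval I p (r c) = 0 := fun c => hr c (by have := c.2.1; omega)
    choose G hG hdG using fun c : Q => W.exists_germDiff_eq (hT k c c.2.1)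
    choose m e he hev hde hGm using fun c : Q => W.exists_linear_part hr (Nat.succ_ne_zero k)
      (fun c hc => ih _ hc c le_rfl) (hspan _ (hG c))
    choose v hv hv' using fun c : Q => hdual c c.2.2
    let A : Matrix Q Q (smoothGerm I p) := Matrix.of m
    -- Apply the differential in the dual direction `v d` to `G c = ∑ m c c' * r c' + e c`. Since
    -- the `r c'` vanish at `p` and `e c` has zero 1-jet, only the value of `m c d` remains, and it
    -- equals `d(r c)(v d)`, which is 1 or 0.
    have hA : (germEval I p).mapMatrix A = 1 := by
      ext c d
      have h1 := congrArg (germDeriv I (v d)) (hGm c)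
      rw [map_add, map_sum] at h1
      have h2 : ∀ c', germDeriv I (v d) (m c c' * r c') =
          if c' = d then germEval I p (m c d) else 0 := by
        intro c'
        refine (germDiff_mul _ _ _).trans ?_
        rw [hQ0, zero_mul, add_zero]
        split_ifs with h
        · rw [h, hv, mul_one]
        · rw [hv' d c' fun hh => h (Subtype.ext hh), mul_zero]
      have h3 : germDeriv I (v d) (e c) = 0 := hde c _
      have h4 : germDeriv I (v d) (G c) = germDiff I (r c) (v d) := by rw [← hdG c]; rfl
      rw [Finset.sum_congr rfl fun c' _ => h2 c', Finset.sum_ite_eq' Finset.univ d,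
        if_pos (Finset.mem_univ d), h3, add_zero, h4] at h1
      refine h1.symm.trans ?_
      rw [Matrix.one_apply]
      split_ifs with h
      · rw [h, hv]
      · exact hv' d c fun hh => h (Subtype.ext hh)
    have hdet : IsUnit A.det := by
      refine isUnit_of_germEval_ne_zero ?_
      rw [RingHom.map_det, hA, Matrix.det_one]
      exact one_ne_zero
    have hmul : ∀ c, A.mulVec (fun d : Q => r d) c ∈ W.stalk (k + 1) p := by
      intro c
      have : A.mulVec (fun d : Q => r d) c = G c - e c := by
        rw [hGm c, add_sub_cancel_right]; rfl
      rw [this]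
      exact sub_mem (hG c) (he c)
    intro c hc
    by_cases hrc : r c = 0
    · rw [hrc]; exact zero_mem _
    -- Cramer's rule: the entries of `A r` lie in the ideal and `det A` is a unit, so each `r c`
    -- lies in the ideal.
    have hadj : A.adjugate.mulVec (A.mulVec fun d : Q => r d) ⟨c, hc, hrc⟩ = A.det * r c := by
      rw [Matrix.mulVec_mulVec, Matrix.adjugate_mul, Matrix.smul_mulVec, Matrix.one_mulVec]
      rfl
    rw [← Ideal.unit_mul_mem_iff_mem _ hdet, ← hadj]
    exact sum_mem fun d _ => Ideal.mul_mem_left _ _ (hmul d)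

end FunctionFiltration

end MonomialEval

/-! ### Conditions (a) and (b) imply a weighted morphism. -/

section GraphMap

variable {E : Type*} [NormedAddCommGroup E] [NormedSpace ℝ E]
  {H : Type*} [TopologicalSpace H] {I : ModelWithCorners ℝ E H}
  {M : Type*} [TopologicalSpace M] [ChartedSpace H M]
  {E' : Type*} [NormedAddCommGroup E'] [NormedSpace ℝ E']
  {H' : Type*} [TopologicalSpace H'] {I' : ModelWithCorners ℝ E' H'}
  {M' : Type*} [TopologicalSpace M'] [ChartedSpace H' M']

/-- The map `x ↦ (f(x), x)`. -/
def graphMap (f : C^∞⟮I, M; I', M'⟯) : C^∞⟮I, M; I'.prod I, M' × M⟯ :=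
  ⟨fun x => (f x, x), f.contMDiff.prodMk contMDiff_id⟩

/-- The pull-back of germs along `x ↦ (f(x), x)`. -/
def germGraph (f : C^∞⟮I, M; I', M'⟯) (p : M) :
    smoothGerm (I'.prod I) (f p, p) →+* smoothGerm I p :=
  germPullback (graphMap f) rfl

theorem germGraph_germFst (f : C^∞⟮I, M; I', M'⟯) {p : M} (a : smoothGerm I' (f p)) :
    germGraph f p (germFst (f p, p) a) = germPullback f rfl a := by
  obtain ⟨g, hg, rfl⟩ := exists_smoothNear a
  rfl

theorem germGraph_germSnd (f : C^∞⟮I, M; I', M'⟯) {p : M} (a : smoothGerm I p) :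
    germGraph f p (germSnd (f p, p) a) = a := by
  obtain ⟨g, hg, rfl⟩ := exists_smoothNear a
  rfl

/-- The velocity of a curve, acting on germs. -/
theorem exists_hasDerivAt_comp {σ : ℝ → M} {p : M} (hσ : MDifferentiableAt 𝓘(ℝ) I σ 0)
    (h0 : σ 0 = p) : ∃ v : TangentSpace I p, ∀ (g : M → ℝ) (hg : SmoothNear I p g),
      HasDerivAt (g ∘ σ) (germDiff I hg.germ v) 0 := by
  subst h0
  refine ⟨mfderiv 𝓘(ℝ) I σ 0 (1 : ℝ), fun g hg => ?_⟩
  have h := hg.mdifferentiableAt.hasMFDerivAt.comp (0 : ℝ) hσ.hasMFDerivAt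
  rw [germDiff_germ]
  let L : ℝ →L[ℝ] ℝ := (mfderiv I 𝓘(ℝ) g (σ 0)).comp (mfderiv 𝓘(ℝ) I σ 0)
  have h' : HasFDerivAt (g ∘ σ) L 0 := h.hasFDerivAt
  exact h'.hasDerivAt

namespace LocalCoordinates

variable {f : C^∞⟮I, M; I', M'⟯} {p : M} {x : LocalCoordinates (I'.prod I) (M' × M)}
  (hp : (f p, p) ∈ x.domain) {J : Set (Fin (Module.finrank ℝ (E' × E)))}
  (hJ : ∀ q : x.domain, (q : M' × M) ∈ graph f ↔ ∀ a ∈ J, x.coord a q = 0)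

include hJ in
theorem germGraph_germCoord_eq_zero {c : Fin (Module.finrank ℝ (E' × E))} (hc : c ∈ J) :
    germGraph f p (x.germCoord hp c) = 0 := by
  refine Subtype.ext (Germ.coe_eq.2 ?_)
  filter_upwards [(graphMap f).contMDiff.continuous.continuousAt.preimage_mem_nhds
    (x.domain.2.mem_nhds hp)] with q hq
  exact (extend_apply (x.coord c) hq).trans ((hJ ⟨graphMap f q, hq⟩).1 rfl c hc)

variable [I.Boundaryless] [I'.Boundaryless]

include hJ in
-- For `c ∉ J` the coordinate line in direction `c` keeps all coordinates in `J` at zero, hence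
-- stays in the graph. Its projection to `M` has the required velocity.
theorem exists_dual_vector {c : Fin (Module.finrank ℝ (E' × E))} (hc : c ∉ J) :
    ∃ v : TangentSpace I p, ∀ d, germDiff I (germGraph f p (x.germCoord hp d)) v =
      if d = c then 1 else 0 := by
  let e₀ : E' × E := (I'.prod I) (x.chart (f p, p))
  let ℓ : ℝ → E' × E := fun t => e₀ + t • x.basis c
  let γ : ℝ → M' × M := fun t => x.chart.symm ((I'.prod I).symm (ℓ t))
  have hℓ : ContDiff ℝ ∞ ℓ := contDiff_const.add (contDiff_id.smul contDiff_const)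
  have hℓ0 : ℓ 0 = e₀ := by simp [ℓ]
  have hγ0 : γ 0 = (f p, p) := by
    simp only [γ, hℓ0, e₀]
    rw [(I'.prod I).left_inv, x.chart.left_inv hp]
  have hopen : IsOpen ((I'.prod I).symm ⁻¹' x.chart.target) :=
    x.chart.open_target.preimage (I'.prod I).continuous_symm
  have h0 : ℓ 0 ∈ (I'.prod I).symm ⁻¹' x.chart.target := by
    rw [hℓ0, mem_preimage, (I'.prod I).left_inv]
    exact x.chart.map_source hp
  have hγ : ContMDiffAt 𝓘(ℝ) (I'.prod I) ∞ γ 0 :=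
    (x.contMDiffOn_invFun.contMDiffAt (hopen.mem_nhds h0)).comp (0 : ℝ) hℓ.contMDiff.contMDiffAt
  have hev : ∀ᶠ t in 𝓝 (0 : ℝ), ℓ t ∈ (I'.prod I).symm ⁻¹' x.chart.target :=
    hℓ.continuous.continuousAt.eventually_mem (hopen.mem_nhds h0)
  have hdom : ∀ t, ℓ t ∈ (I'.prod I).symm ⁻¹' x.chart.target → γ t ∈ x.domain :=
    fun t ht => x.chart.map_target ht
  have hcoord : ∀ t (ht : ℓ t ∈ (I'.prod I).symm ⁻¹' x.chart.target) d,
      x.coord d ⟨γ t, hdom t ht⟩ = x.coord d ⟨(f p, p), hp⟩ + t * if d = c then 1 else 0 := by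
    intro t ht d
    change x.basis.repr ((I'.prod I) (x.chart (x.chart.symm ((I'.prod I).symm (ℓ t))))) d =
      x.basis.repr e₀ d + _
    rw [x.chart.right_inv ht, (I'.prod I).right_inv ((I'.prod I).range_eq_univ ▸ mem_univ _),
      map_add, map_smul, Module.Basis.repr_self, Finsupp.add_apply, Finsupp.smul_apply,
      Finsupp.single_apply, smul_eq_mul]
    simp only [eq_comm]
  -- Since the line lies in the graph, it is recovered from its projection to `M`; the pulled-back
  -- coordinates along the projection are thus the original ones along the line.
  have hgraph : ∀ t, ℓ t ∈ (I'.prod I).symm ⁻¹' x.chart.target →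
      graphMap f (γ t).2 = γ t := by
    intro t ht
    have : γ t ∈ graph f := by
      refine (hJ ⟨γ t, hdom t ht⟩).2 fun d hd => ?_
      rw [hcoord t ht d, (hJ ⟨(f p, p), hp⟩).1 rfl d hd, if_neg fun h : d = c => hc (h ▸ hd)]
      ring
    exact Prod.ext (Eq.symm this) rfl
  have hσ : MDifferentiableAt 𝓘(ℝ) I (fun t => (γ t).2) 0 :=
    ((contMDiff_snd.contMDiffAt).comp (0 : ℝ) hγ).mdifferentiableAt (by simp)
  obtain ⟨v, hv⟩ := exists_hasDerivAt_comp hσ (p := p) (by rw [hγ0])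
  refine ⟨v, fun d => ?_⟩
  have h1 := hv _ ((smoothNear_extend (x.coord d) hp).comp (f := graphMap f) rfl)
  have h2 : HasDerivAt (fun t : ℝ => x.coord d ⟨(f p, p), hp⟩ + t * if d = c then 1 else 0)
      (if d = c then 1 else 0) 0 := by
    simpa using ((hasDerivAt_id (0 : ℝ)).mul_const (if d = c then (1 : ℝ) else 0)).const_add
      (x.coord d ⟨(f p, p), hp⟩)
  refine h1.unique (h2.congr_of_eventuallyEq ?_)
  filter_upwards [hev] with t ht
  rw [← hcoord t ht d, ← extend_apply (x.coord d) (hdom t ht)]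
  exact congrArg _ (hgraph t ht)

end LocalCoordinates

namespace FunctionFiltration

variable {W : FunctionFiltration I M} {W' : FunctionFiltration I' M'} {f : C^∞⟮I, M; I', M'⟯}
  {p : M}

theorem germGraph_mem_span {i : ℕ} {a : smoothGerm (I'.prod I) (f p, p)}
    (ha : a ∈ (W'.prod W).stalk i (f p, p)) :
    germGraph f p a ∈ Ideal.span {c | ∃ j k, j + k = i ∧ ∃ a ∈ W'.stalk j (f p),
      ∃ b ∈ W.stalk k p, c = germPullback f rfl a * b} := by
  rw [stalk_prod] at ha
  have := Ideal.mem_map_of_mem (germGraph f p) ha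
  rw [Ideal.map_span] at this
  refine Ideal.span_mono ?_ this
  rintro _ ⟨_, ⟨j, k, hjk, a, ha, b, hb, rfl⟩, rfl⟩
  refine ⟨j, k, hjk, a, ha, b, hb, ?_⟩
  rw [map_mul]
  exact congrArg₂ (· * ·) (germGraph_germFst f a) (germGraph_germSnd f b)

/-- In a generator `f^*a · b` of positive total degree one factor has positive degree, and so
vanishes at `p`. -/
theorem germEval_germGraph_eq_zero (hp : p ∈ W.locus) (hfp : f p ∈ W'.locus) {i : ℕ} (hi : i ≠ 0)
    {a : smoothGerm (I'.prod I) (f p, p)} (ha : a ∈ (W'.prod W).stalk i (f p, p)) :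
    germEval I p (germGraph f p a) = 0 := by
  have h := germGraph_mem_span ha
  have hle : Ideal.span {c | ∃ j k, j + k = i ∧ ∃ a ∈ W'.stalk j (f p),
      ∃ b ∈ W.stalk k p, c = germPullback f rfl a * b} ≤ RingHom.ker (germEval I p) := by
    refine Ideal.span_le.2 ?_
    rintro _ ⟨j, k, hjk, a, ha, b, hb, rfl⟩
    rw [SetLike.mem_coe, RingHom.mem_ker, map_mul, germEval_germPullback]
    by_cases hj : j = 0
    · rw [W.germEval_eq_zero hp (by omega) hb, mul_zero]
    · rw [W'.germEval_eq_zero hfp hj ha, zero_mul]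
  exact hle h

theorem mem_locus_prod (hp : p ∈ W.locus) (hfp : f p ∈ W'.locus) :
    (f p, p) ∈ (W'.prod W).locus := by
  refine (mem_locus_iff _).2 ⟨1, fun htop => ?_⟩
  have := germEval_germGraph_eq_zero hp hfp one_ne_zero ((Ideal.eq_top_iff_one _).1 htop)
  rw [map_one, map_one] at this
  exact one_ne_zero this

variable [FiniteDimensional ℝ E] [IsManifold I ∞ M] [T2Space M]
  [FiniteDimensional ℝ E'] [IsManifold I' ∞ M'] [T2Space M']

/-- For a generator `f^*a · b` of degree `i + 1`: if both degrees are positive, both factors vanish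
at `p` and so does the differential. Otherwise one factor carries the full degree, and `v` kills
`b`, or `Tf v` kills `a` by (b). -/
theorem PreservesTangentFiltration.germDiff_germGraph_eq_zero
    (hT : W.PreservesTangentFiltration W' f) (hp : p ∈ W.locus) (hfp : f p ∈ W'.locus) {i : ℕ}
    {a : smoothGerm (I'.prod I) (f p, p)} (ha : a ∈ (W'.prod W).stalk (i + 1) (f p, p))
    {v : TangentSpace I p} (hv : v ∈ W.tangentFiltration i p) :
    germDiff I (germGraph f p a) v = 0 := by
  -- The value is carried along because multiplying by an arbitrary coefficient preserves a zero
  -- differential only when the value vanishes too.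
  suffices h : germEval I p (germGraph f p a) = 0 ∧ germDiff I (germGraph f p a) v = 0 from h.2
  have hmem := germGraph_mem_span ha
  generalize germGraph f p a = a' at hmem ⊢
  induction hmem using Submodule.span_induction with
  | zero => exact ⟨map_zero _, map_zero (germDeriv I v)⟩
  | add a b _ _ ha hb =>
    exact ⟨by rw [map_add, ha.1, hb.1, add_zero],
      by rw [germDiff_add, add_apply, ha.2, hb.2, add_zero]⟩
  | smul c a _ ha =>
    rw [smul_eq_mul]
    exact ⟨by rw [map_mul, ha.1, mul_zero], by rw [germDiff_mul, ha.1, ha.2]; ring⟩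
  | mem a ha =>
    obtain ⟨j, k, hjk, a, ha, b, hb, rfl⟩ := ha
    rw [germDiff_mul, map_mul, germEval_germPullback, germDiff_germPullback]
    by_cases hj : j = 0
    · have hk : k = i + 1 := by omega
      subst hk
      rw [W.germEval_eq_zero hp (by omega) hb, W.mem_tangentFiltration_iff.1 hv b hb]
      constructor <;> ring
    · rw [W'.germEval_eq_zero hfp hj ha]
      by_cases hk : k = 0
      · have hj : j = i + 1 := by omega
        subst hj
        rw [W'.mem_tangentFiltration_iff.1 (hT p hp i v hv) a ha]
        constructor <;> ring
      · rw [W.germEval_eq_zero hp hk hb]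
        constructor <;> ring

variable [I.Boundaryless] [I'.Boundaryless]

theorem PreservesTangentFiltration.isWeightedMorphism
    (hT : W.PreservesTangentFiltration W' f) (hf : MapsTo f W.locus W'.locus)
    (hΓ : (W'.prod W).IsWeightedSubmanifold (graph f)) : W.IsWeightedMorphism W' f := by
  refine (W.isWeightedMorphism_iff W' f).2 fun p i a ha => ?_
  by_cases hp : p ∈ W.locus
  swap
  · rw [W.stalk_eq_top hp]; trivial
  have hfp := hf hp
  obtain ⟨x, u, hx, hxu, J, hJ⟩ := hΓ.2 (f p, p) ⟨rfl, mem_locus_prod hp hfp⟩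
  let r := fun c => germGraph f p (x.germCoord hx c)
  have hmap : ∀ k, ((W'.prod W).stalk k (f p, p)).map (germGraph f p) = monomialSpan r u k := by
    intro k
    rw [hxu.stalk_eq hx, map_monomialSpan]
  have hcoord : ∀ c, x.germCoord hx c ∈ (W'.prod W).stalk (u c) (f p, p) := fun c => by
    rw [hxu.stalk_eq hx]; exact self_mem_monomialSpan _ _ c
  have hr : ∀ c, r c ∈ W.stalk (u c) p := by
    refine W.mem_stalk_of_stalk_le_monomialSpan (fun k b hb => ?_)
      (fun c hc => germEval_germGraph_eq_zero hp hfp hc (hcoord c)) (fun k c hk v hv => ?_)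
      fun c hc => ?_
    -- The second projection composed with `γ` is the identity, so a germ on `M` is the pull-back of
    -- one of the same degree on the product.
    · rw [← hmap, ← germGraph_germSnd f b]
      exact Ideal.mem_map_of_mem _ (germSnd_mem_stalk_prod (z := (f p, p)) hb)
    · exact hT.germDiff_germGraph_eq_zero hp hfp (stalk_antitone _ _ hk (hcoord c)) hv
    · obtain ⟨v, hv⟩ := LocalCoordinates.exists_dual_vector hx hJ fun hcJ =>
        hc (LocalCoordinates.germGraph_germCoord_eq_zero hx hJ hcJ)
      exact ⟨v, (hv c).trans (if_pos rfl), fun d hd => (hv d).trans (if_neg hd)⟩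
  -- Likewise `f` is the first projection composed with `γ`, which places `f^*a` in the ideal of
  -- monomials in `r`.
  rw [← germGraph_germFst]
  refine monomialSpan_le (G := fun k => W.stalk k p) (W.stalk_zero p) (W.stalk_antitone p)
    (fun i j a b => W.mul_mem_stalk) hr i ?_
  rw [← hmap]
  exact Ideal.mem_map_of_mem _ (germFst_mem_stalk_prod (z := (f p, p)) ha)

end FunctionFiltration

end GraphMap

end WeightedManifold

end

theorem mainTheorem7
    {E : Type*} [NormedAddCommGroup E] [NormedSpace ℝ E] [FiniteDimensional ℝ E]
    {H : Type*} [TopologicalSpace H] (I : ModelWithCorners ℝ E H) [I.Boundaryless]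
    {M : Type*} [TopologicalSpace M] [ChartedSpace H M] [IsManifold I ∞ M]
    [T2Space M] [SecondCountableTopology M]
    {E' : Type*} [NormedAddCommGroup E'] [NormedSpace ℝ E'] [FiniteDimensional ℝ E']
    {H' : Type*} [TopologicalSpace H'] (I' : ModelWithCorners ℝ E' H') [I'.Boundaryless]
    {M' : Type*} [TopologicalSpace M'] [ChartedSpace H' M'] [IsManifold I' ∞ M']
    [T2Space M'] [SecondCountableTopology M']
    (W : WeightedManifold.FunctionFiltration I M) (hW : W.IsWeighting)
    (W' : WeightedManifold.FunctionFiltration I' M') (hW' : W'.IsWeighting)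
    (f : C^∞⟮I, M; I', M'⟯) (hf : Set.MapsTo f W.locus W'.locus) :
    W.IsWeightedMorphism W' f ↔
      (W'.prod W).IsWeightedSubmanifold (WeightedManifold.graph f) ∧
        W.PreservesTangentFiltration W' f :=
  ⟨fun h => ⟨h.isWeightedSubmanifold_graph hW hW', h.preservesTangentFiltration⟩,
    fun h => h.2.isWeightedMorphism hf h.1⟩
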